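/- **Theorem 2 (Convergence of dual BCD).** Let $A^{(i)}_j\in\mathbb R^{n_1\times n_2\times n_3}$ ($1\le i\le N$, $1\le j\le m_i$) be nonzero tensors with entries in $\{0,1\}$ such that, for each $i$, the Hadamard product $A^{(i)}_j\circ A^{(i)}_k$ vanishes whenever $j\neq k$. Put $\mathcal A^{(i)}(X)=(\langle A^{(i)}_j,X\rangle)_{j}\in\mathbb R^{m_i}$ and $\mathcal A^{(i,*)}y=\sum_j y_jA^{(i)}_j$. Let $b^{(i)}\in\mathbb R^{m_i}$, let $C\in\mathbb R^{n_1\times n_2\times n_3}$, and let $U$ be a tensor with entries in $[0,\infty]$. Assume that $\Omega=\{X:\mathcal A^{(i)}(X)=b^{(i)}\ (1\le i\le N),\ 0\le X\le U\}$ is bounded and contains a tensor with all entries positive. Let $S$ be a tensor with all entries positive and let $\varepsilon>0$. With $\phi(X)=\sum_{rst}(X_{rst}\log X_{rst}-X_{rst})$ for $X\ge0$ (where $0\log0=0$), $\phi(X)=+\infty$ otherwise, and $\mathcal D_\phi(X,S)=\phi(X)-\phi(S)-\langle\log S,X-S\rangle$, consider the subproblem $$\min_X\ \langle C,X\rangle+\varepsilon\,\mathcal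 D_\phi(X,S)\quad\text{s.t.}\quad \mathcal A^{(i)}(X)=b^{(i)}\ (1\le i\le N),\quad X\le U, \tag{P}$$ and, with $M=C-\varepsilon\log S$ and $\widetilde M=\exp(-M/\varepsilon)$ (entrywise), its dual $$\min_{y^{(1)},\dots,y^{(N)},W}\ R(y^{(1)},\dots,y^{(N)},W)=\varepsilon\Big\langle\widetilde M,\exp\Big(\varepsilon^{-1}\Big(W+\sum_{i=1}^N\mathcal A^{(i,*)}y^{(i)}\Big)\Big)\Big\rangle-\sum_{i=1}^N\langle y^{(i)},b^{(i)}\rangle-\langle W,U\rangle+\delta_-(W), \tag{D}$$ where $\delta_-(W)=0$ if $W\le 0$ and $+\infty$ otherwise, $0\cdot\infty=0$, and $R=+\infty$ whenever $W\not\le0$. Let $(y^{(1),\ell},\dots,y^{(N),\ell},W^\ell)_{\ell\ge0}$ be generated by cyclic dual block coordinate descent: the starting point is any point at which $R<+\infty$, and for every $\ell\ge0$ $$y^{(i),\ell+1}\in\arg\min_{v\in\mathbb R^{m_i}}R\big(y^{(1),\ell+1},\dots,y^{(i-1),\ell+1},v,y^{(i+1),\ell},\dots,y^{(N),\ell},W^\ell\big)\quad(i=1,\dots,N),$$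 $$W^{\ell+1}\in\arg\min_{W}R\big(y^{(1),\ell+1},\dots,y^{(N),\ell+1},W\big).$$ Let $X^\ell=\exp\big(\varepsilon^{-1}\big(\sum_{i=1}^N\mathcal A^{(i,*)}y^{(i),\ell}+W^\ell-M\big)\big)$. Then: (i) $(y^{(1),\ell},\dots,y^{(N),\ell},W^\ell)$ converges R-linearly to an optimal solution of (D); (ii) (P) has exactly one optimal solution, and $X^\ell$ converges R-linearly to it. Here $x^\ell\to\bar x$ R-linearly means that there are $c>0$ and $\rho\in(0,1)$ with $\|x^\ell-\bar x\|\le c\,\rho^\ell$ for all $\ell\ge0$, where $\|\cdot\|$ is the Euclidean (Frobenius) norm. -/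

import Mathlib

open scoped ENNReal

noncomputable section

namespace DualBCD

/-- Real third-order tensors of size `n₁ × n₂ × n₃`. -/
abbrev Tensor (n₁ n₂ n₃ : ℕ) : Type := Fin n₁ × Fin n₂ × Fin n₃ → ℝ

/-- The standard inner product of tensors. -/
def tinner {n₁ n₂ n₃ : ℕ} (X Y : Tensor n₁ n₂ n₃) : ℝ := ∑ p, X p * Y p

/-- The Frobenius norm of a tensor. -/
def frobNorm {n₁ n₂ n₃ : ℕ} (X : Tensor n₁ n₂ n₃) : ℝ := Real.sqrt (tinner X X)

/-- The blocks `(y⁽¹⁾, …, y⁽ᴺ⁾)` of multipliers, with `y⁽ⁱ⁾ ∈ ℝ^{mᵢ}`. -/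
abbrev Blocks {N : ℕ} (m : Fin N → ℕ) : Type := (i : Fin N) → Fin (m i) → ℝ

/-- The Euclidean norm of the full vector `(y⁽¹⁾, …, y⁽ᴺ⁾, W)`. -/
def dualNorm {n₁ n₂ n₃ N : ℕ} {m : Fin N → ℕ} (y : Blocks m) (W : Tensor n₁ n₂ n₃) : ℝ :=
  Real.sqrt ((∑ i, ∑ j, y i j ^ 2) + ∑ p, W p ^ 2)

/-- The data of the structured linear program
`min ⟨C, X⟩` subject to `𝒜⁽ⁱ⁾(X) = b⁽ⁱ⁾` for all `i`, and `0 ≤ X ≤ U`.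
The entries of `U` are nonnegative reals or `∞`. -/
structure LPData (n₁ n₂ n₃ N : ℕ) (m : Fin N → ℕ) where
  /-- the constraint tensors `A⁽ⁱ⁾ⱼ` -/
  A : (i : Fin N) → Fin (m i) → Tensor n₁ n₂ n₃
  /-- the right-hand sides `b⁽ⁱ⁾` -/
  b : Blocks m
  /-- the cost tensor -/
  C : Tensor n₁ n₂ n₃
  /-- the upper bounds -/
  U : Fin n₁ × Fin n₂ × Fin n₃ → ℝ≥0∞

variable {n₁ n₂ n₃ N : ℕ} {m : Fin N → ℕ}

namespace LPData

/-- The linear mapping `𝒜⁽ⁱ⁾`. -/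
def Amap (P : LPData n₁ n₂ n₃ N m) (i : Fin N) (X : Tensor n₁ n₂ n₃) : Fin (m i) → ℝ :=
  fun j => tinner (P.A i j) X

/-- The adjoint mapping `𝒜⁽ⁱ'*⁾ z = ∑ⱼ zⱼ A⁽ⁱ⁾ⱼ`. -/
def Aadj (P : LPData n₁ n₂ n₃ N m) (i : Fin N) (z : Fin (m i) → ℝ) : Tensor n₁ n₂ n₃ :=
  fun p => ∑ j, z j * P.A i j p

/-- `Ω° = {X : 𝒜⁽ⁱ⁾(X) = b⁽ⁱ⁾ for all i, X ≤ U}`. -/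
def OmegaCirc (P : LPData n₁ n₂ n₃ N m) : Set (Tensor n₁ n₂ n₃) :=
  {X | (∀ i, P.Amap i X = P.b i) ∧ ∀ p, ((X p : ℝ) : EReal) ≤ ((P.U p : ℝ≥0∞) : EReal)}

/-- The feasible set `Ω = {X ∈ Ω° : X ≥ 0}` of the linear program. -/
def Omega (P : LPData n₁ n₂ n₃ N m) : Set (Tensor n₁ n₂ n₃) :=
  {X | X ∈ P.OmegaCirc ∧ ∀ p, 0 ≤ X p}

/-- Every `A⁽ⁱ⁾ⱼ` is a nonzero tensor with entries in `{0, 1}`, and inside each block `i` the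
Hadamard product of any two distinct constraint tensors vanishes. -/
def NonOverlapping (P : LPData n₁ n₂ n₃ N m) : Prop :=
  (∀ i j p, P.A i j p = 0 ∨ P.A i j p = 1) ∧
  (∀ i j, P.A i j ≠ 0) ∧
  (∀ i j k, j ≠ k → ∀ p, P.A i j p * P.A i k p = 0)

/-- `Ω` is bounded and contains a tensor all of whose entries are positive. -/
def Feasible (P : LPData n₁ n₂ n₃ N m) : Prop :=
  Bornology.IsBounded P.Omega ∧ ∃ X ∈ P.Omega, ∀ p, 0 < X p

end LPData

/-- The Boltzmann–Shannon entropy `φ(X) = ∑ (X log X - X)`, with `0 log 0 = 0`, as an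
extended-valued function with domain the nonnegative tensors. -/
def entropy (X : Tensor n₁ n₂ n₃) : EReal :=
  if ∀ p, 0 ≤ X p then ((∑ p, (X p * Real.log (X p) - X p) : ℝ) : EReal) else ⊤

/-- The Bregman distance `φ(X) - φ(Y) - ⟨∇φ(Y), X - Y⟩`, used for positive `Y`, where
`∇φ(Y) = log Y` entrywise. -/
def bregman (X Y : Tensor n₁ n₂ n₃) : EReal :=
  entropy X - entropy Y - ((tinner (fun p => Real.log (Y p)) (X - Y) : ℝ) : EReal)

/-- The objective `⟨C, X⟩ + ε D_φ(X, S)` of the subproblem. -/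
def primalObj (P : LPData n₁ n₂ n₃ N m) (S : Tensor n₁ n₂ n₃) (ε : ℝ)
    (X : Tensor n₁ n₂ n₃) : EReal :=
  ((tinner P.C X : ℝ) : EReal) + (ε : EReal) * bregman X S

/-- `X` is an optimal solution of the subproblem
`min ⟨C, X⟩ + ε D_φ(X, S)` subject to `𝒜⁽ⁱ⁾(X) = b⁽ⁱ⁾` for all `i`, and `X ≤ U`. -/
def IsPrimalOptimal (P : LPData n₁ n₂ n₃ N m) (S : Tensor n₁ n₂ n₃) (ε : ℝ)
    (X : Tensor n₁ n₂ n₃) : Prop :=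
  X ∈ P.OmegaCirc ∧ IsMinOn (primalObj P S ε) P.OmegaCirc X

/-- `M = C - ε log S`. -/
def Mten (P : LPData n₁ n₂ n₃ N m) (S : Tensor n₁ n₂ n₃) (ε : ℝ) : Tensor n₁ n₂ n₃ :=
  fun p => P.C p - ε * Real.log (S p)

/-- `M̃ = exp(-M/ε)`, entrywise. -/
def Mtilde (P : LPData n₁ n₂ n₃ N m) (S : Tensor n₁ n₂ n₃) (ε : ℝ) : Tensor n₁ n₂ n₃ :=
  fun p => Real.exp (-(Mten P S ε p) / ε)

/-- `W + ∑ᵢ 𝒜⁽ⁱ'*⁾ y⁽ⁱ⁾`. -/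
def dualSum (P : LPData n₁ n₂ n₃ N m) (y : Blocks m) (W : Tensor n₁ n₂ n₃) : Tensor n₁ n₂ n₃ :=
  fun p => W p + ∑ i, P.Aadj i (y i) p

/-- The dual objective
`R(y, W) = ε ⟨M̃, exp(ε⁻¹ (W + ∑ᵢ 𝒜⁽ⁱ'*⁾ y⁽ⁱ⁾))⟩ - ∑ᵢ ⟨y⁽ⁱ⁾, b⁽ⁱ⁾⟩ - ⟨W, U⟩ + δ₋(W)`.
Where `W ≤ 0`, the term `-⟨W, U⟩ = ∑ (-W) U` lies in `[0, ∞]`, with `0 · ∞ = 0`. -/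
def R (P : LPData n₁ n₂ n₃ N m) (S : Tensor n₁ n₂ n₃) (ε : ℝ)
    (y : Blocks m) (W : Tensor n₁ n₂ n₃) : EReal :=
  if ∀ p, W p ≤ 0 then
    ((ε * tinner (Mtilde P S ε) (fun p => Real.exp (ε⁻¹ * dualSum P y W p))
        - ∑ i, ∑ j, y i j * P.b i j : ℝ) : EReal)
      + ((∑ p, ENNReal.ofReal (-(W p)) * P.U p : ℝ≥0∞) : EReal)
  else ⊤

/-- `(y, W)` is an optimal solution of the dual problem `min R`. -/
def IsDualOptimal (P : LPData n₁ n₂ n₃ N m) (S : Tensor n₁ n₂ n₃) (ε : ℝ)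
    (y : Blocks m) (W : Tensor n₁ n₂ n₃) : Prop :=
  ∀ (y' : Blocks m) (W' : Tensor n₁ n₂ n₃), R P S ε y W ≤ R P S ε y' W'

/-- The blocks `(ynew⁽¹⁾, …, ynew⁽ⁱ⁻¹⁾, v, yold⁽ⁱ⁺¹⁾, …, yold⁽ᴺ⁾)`. -/
def cyclicArg (ynew yold : Blocks m) (i : Fin N) (v : Fin (m i) → ℝ) : Blocks m :=
  Function.update (fun k => if k < i then ynew k else yold k) i v

/-- `(y ℓ, W ℓ)`, `ℓ ≥ 0`, is generated by the cyclic dual block coordinate descent method: the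
starting point is any point of `dom R`, and in every cycle `R` is minimized first over
`y⁽¹⁾, …, y⁽ᴺ⁾` in turn, then over `W`, always at the latest values of the other blocks. -/
def IsDualBCD (P : LPData n₁ n₂ n₃ N m) (S : Tensor n₁ n₂ n₃) (ε : ℝ)
    (y : ℕ → Blocks m) (W : ℕ → Tensor n₁ n₂ n₃) : Prop :=
  R P S ε (y 0) (W 0) < ⊤ ∧
  ∀ ℓ : ℕ,
    (∀ i : Fin N, IsMinOn (fun v => R P S ε (cyclicArg (y (ℓ + 1)) (y ℓ) i v) (W ℓ))
      Set.univ (y (ℓ + 1) i)) ∧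
    IsMinOn (fun V => R P S ε (y (ℓ + 1)) V) Set.univ (W (ℓ + 1))

/-- The primal tensor `exp(ε⁻¹ (∑ᵢ 𝒜⁽ⁱ'*⁾ y⁽ⁱ⁾ + W - M))`, entrywise. -/
def primalOf (P : LPData n₁ n₂ n₃ N m) (S : Tensor n₁ n₂ n₃) (ε : ℝ)
    (y : Blocks m) (W : Tensor n₁ n₂ n₃) : Tensor n₁ n₂ n₃ :=
  fun p => Real.exp (ε⁻¹ * (dualSum P y W p - Mten P S ε p))

/-- The errors `e ℓ` (distances of the iterates to their limit) tend to zero R-linearly: they are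
bounded by a geometric sequence `c ρ^ℓ` with ratio `ρ ∈ (0, 1)`. -/
def RLinear (e : ℕ → ℝ) : Prop :=
  ∃ c : ℝ, 0 < c ∧ ∃ ρ : ℝ, 0 < ρ ∧ ρ < 1 ∧ ∀ ℓ, e ℓ ≤ c * ρ ^ ℓ

end DualBCD

end

/-!
Write `X = exp (ε⁻¹ (∑ᵢ 𝒜⁽ⁱ'*⁾ y⁽ⁱ⁾ + W - M))` for the primal tensor of a dual point. The proof is a
descent argument for the values of the dual objective, in which neither the existence of a dual
solution nor the boundedness of the dual iterates is presupposed.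

*A priori bounds.* For a feasible tensor `Y`, the duality gap at `Y` and `(y, W)` is exactly a
relative entropy of `Y` with respect to `X` plus the complementarity term `⟨-W, U - Y⟩`
(`dualVal_add_entropicCost`). Taking `Y` positive shows that `log X` is bounded on sublevel sets of
the dual objective (`exists_boundedLog`).

*Sufficient descent.* By the exact expansion `dualVal_sub_dualVal` and the optimality conditions of
the block minimizations, every block update decreases the dual objective by at least a multiple of
the squared change of `dualSum` (`sq_dualSum_sub_le`). Since the constraint tensors of a block do
not overlap, this also controls the change of the multipliers.

*Suboptimality.* After a cycle, `X ≤ U` and complementarity hold exactly, and the residual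
`𝒜(X) - b` is of the order of the step (`IsCycle.abs_Amap_sub_le`). A Hoffman bound
(`exists_hoffman_box`) moves `X` by that order to a feasible `Y` with the same active upper bounds.
The gap at `Y` is then a pure relative entropy, hence of the order of the squared step, and by weak
duality it bounds what the dual objective can still lose (`exists_dualVal_sub_le`).

Together, what is left to lose is at most a multiple of the last decrease, so the decreases are
dominated by a geometric sequence (`exists_geometric_of_sub_le_mul_sub`). The steps, being square
roots of the decreases, are summable, and the iterates converge geometrically. The limit satisfies
the Karush–Kuhn–Tucker conditions (`isKKT_of_tendsto`), which imply optimality for both problems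
and, because the relative entropy is definite, uniqueness of the primal solution.
-/

open scoped ENNReal

noncomputable section

namespace DualBCD

/-! ### Scalar inequalities for the exponential and the relative entropy -/

/-- On a bounded range, `exp (-t)` lies above its tangent at `0` by a multiple of `t ^ 2`. -/
lemma sq_le_exp_neg_sub {D t : ℝ} (ht : |t| ≤ D) :
    1 / (2 * (D + 2)) * t ^ 2 ≤ Real.exp (-t) - 1 + t := by
  have hD : 0 ≤ D := (abs_nonneg t).trans ht
  have htD : t ≤ D := (le_abs_self t).trans ht
  rw [div_mul_eq_mul_div, one_mul, div_le_iff₀ (by positivity)]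
  rcases le_total t 2 with h2 | h2
  · have h1 : 1 - t / 2 ≤ Real.exp (-t / 2) := by
      have := Real.add_one_le_exp (-t / 2); linarith
    have h3 : Real.exp (-t) = Real.exp (-t / 2) ^ 2 := by
      rw [← Real.exp_nat_mul]; congr 1; push_cast; ring
    have h4 : (1 - t / 2) ^ 2 ≤ Real.exp (-t / 2) ^ 2 :=
      pow_le_pow_left₀ (by linarith) h1 2
    nlinarith [mul_nonneg hD (sq_nonneg t)]
  · have := Real.exp_pos (-t)
    nlinarith [mul_nonneg (sub_nonneg.2 h2) hD]

lemma exp_neg_sub_nonneg (t : ℝ) : 0 ≤ Real.exp (-t) - 1 + t := by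
  have := Real.add_one_le_exp (-t); linarith

lemma abs_exp_sub_exp_le {a b B : ℝ} (ha : Real.exp a ≤ B) (hb : Real.exp b ≤ B) :
    |Real.exp a - Real.exp b| ≤ B * |a - b| := by
  wlog h : b ≤ a generalizing a b
  · rw [abs_sub_comm, abs_sub_comm a b]; exact this hb ha (le_of_not_ge h)
  rw [abs_of_nonneg (sub_nonneg.2 (Real.exp_le_exp.2 h)), abs_of_nonneg (sub_nonneg.2 h)]
  have h1 := Real.add_one_le_exp (b - a)
  have h2 : Real.exp b = Real.exp a * Real.exp (b - a) := by rw [← Real.exp_add]; congr 1; ring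
  have h3 := Real.exp_pos a
  calc Real.exp a - Real.exp b ≤ Real.exp a * (a - b) := by rw [h2]; nlinarith
    _ ≤ B * (a - b) := mul_le_mul_of_nonneg_right ha (sub_nonneg.2 h)

/-- First-order condition at `0` from variations in the negative direction. -/
lemma le_of_forall_mul_one_sub_exp_le {X u : ℝ} (hX : 0 ≤ X)
    (h : ∀ t, 0 < t → X * (1 - Real.exp (-t)) ≤ t * u) : X ≤ u := by
  have key : ∀ t, 0 < t → X ≤ u + t * u := by
    intro t ht
    have h1 := h t ht
    have h2 : Real.exp (-t) * (1 + t) ≤ 1 := by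
      have := Real.add_one_le_exp t
      calc Real.exp (-t) * (1 + t) ≤ Real.exp (-t) * Real.exp t := by
            gcongr; linarith
        _ = 1 := by rw [← Real.exp_add]; simp
    have h3 : t ≤ (1 - Real.exp (-t)) * (1 + t) := by nlinarith
    have h4 : X * t ≤ t * u * (1 + t) := by
      calc X * t ≤ X * ((1 - Real.exp (-t)) * (1 + t)) := by gcongr
        _ = X * (1 - Real.exp (-t)) * (1 + t) := by ring
        _ ≤ t * u * (1 + t) := by gcongr
    nlinarith
  have hlim : Filter.Tendsto (fun t : ℝ => u + t * u) (nhdsWithin 0 (Set.Ioi 0)) (nhds u) := by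
    have : Continuous (fun t : ℝ => u + t * u) := by fun_prop
    simpa using (this.tendsto 0).mono_left nhdsWithin_le_nhds
  exact ge_of_tendsto hlim (by filter_upwards [self_mem_nhdsWithin] with t ht using key t ht)

/-- First-order condition at `0` from variations in the positive direction. -/
lemma le_of_forall_le_mul_exp_sub_one {X u η : ℝ} (hη : 0 < η) (hX : 0 ≤ X)
    (h : ∀ t, 0 < t → t < η → t * u ≤ X * (Real.exp t - 1)) : u ≤ X := by
  have key : ∀ t, 0 < t → t < η → u ≤ X * Real.exp t := by
    intro t ht htη
    have h1 := h t ht htη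
    have h2 : Real.exp t - 1 ≤ t * Real.exp t := by
      have h3 := Real.add_one_le_exp (-t)
      have h4 : Real.exp (-t) * Real.exp t = 1 := by rw [← Real.exp_add]; simp
      nlinarith [Real.exp_pos t]
    have : t * u ≤ t * (X * Real.exp t) := by
      calc t * u ≤ X * (Real.exp t - 1) := h1
        _ ≤ X * (t * Real.exp t) := by gcongr
        _ = _ := by ring
    exact le_of_mul_le_mul_left this ht
  have hlim : Filter.Tendsto (fun t : ℝ => X * Real.exp t) (nhdsWithin 0 (Set.Ioi 0)) (nhds X) := by
    have : Continuous (fun t : ℝ => X * Real.exp t) := by fun_prop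
    simpa using (this.tendsto 0).mono_left nhdsWithin_le_nhds
  refine ge_of_tendsto hlim ?_
  filter_upwards [Ioo_mem_nhdsGT hη] with t ht using key t ht.1 ht.2

/-- One entry of the Bregman distance of the Boltzmann–Shannon entropy, i.e. the generalized
relative entropy of nonnegative numbers. -/
def relEnt (a x : ℝ) : ℝ := a * Real.log a - a * Real.log x - a + x

lemma relEnt_eq_klFun {a x : ℝ} (ha : 0 ≤ a) (hx : 0 < x) :
    relEnt a x = x * InformationTheory.klFun (a / x) := by
  unfold relEnt InformationTheory.klFun
  rcases ha.eq_or_lt with rfl | ha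
  · simp
  · rw [Real.log_div ha.ne' hx.ne']; field_simp; ring

lemma relEnt_nonneg {a x : ℝ} (ha : 0 ≤ a) (hx : 0 < x) : 0 ≤ relEnt a x := by
  rw [relEnt_eq_klFun ha hx]
  exact mul_nonneg hx.le (InformationTheory.klFun_nonneg (by positivity))

lemma relEnt_self (a : ℝ) : relEnt a a = 0 := by unfold relEnt; ring

lemma eq_of_relEnt_eq_zero {a x : ℝ} (ha : 0 ≤ a) (hx : 0 < x) (h : relEnt a x = 0) : a = x := by
  rw [relEnt_eq_klFun ha hx, mul_eq_zero, or_iff_right hx.ne',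
    InformationTheory.klFun_eq_zero_iff (by positivity), div_eq_one_iff_eq hx.ne'] at h
  exact h

lemma relEnt_le_sq_div {a x : ℝ} (ha : 0 < a) (hx : 0 < x) : relEnt a x ≤ (a - x) ^ 2 / x := by
  have h1 := Real.log_le_sub_one_of_pos (div_pos ha hx)
  rw [Real.log_div ha.ne' hx.ne'] at h1
  have h2 : a * (Real.log a - Real.log x) ≤ a * (a / x - 1) := by gcongr
  have h3 : (a - x) ^ 2 / x = a * (a / x - 1) - a + x := by field_simp; ring
  unfold relEnt; linarith

/-- The relative entropy grows at least linearly in `log x`, in both directions. -/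
lemma abs_log_sub_log_le {a x : ℝ} (ha : 0 < a) (hx : 0 < x) :
    |Real.log x - Real.log a| ≤ relEnt a x / a + 1 := by
  set s := Real.log x - Real.log a with hs
  have h1 : x = a * Real.exp s := by
    rw [hs, Real.exp_sub, Real.exp_log hx, Real.exp_log ha]; field_simp
  have h2 : relEnt a x / a = Real.exp s - 1 - s := by
    have : relEnt a x = a * (Real.exp s - 1 - s) := by
      unfold relEnt
      have : a * Real.log a - a * Real.log x = - (a * s) := by rw [hs]; ring
      rw [this]; linear_combination h1
    rw [this]; field_simp
  rw [h2]
  rcases le_total 0 s with h | h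
  · rw [abs_of_nonneg h]
    have := Real.quadratic_le_exp_of_nonneg h
    nlinarith [sq_nonneg (s - 1)]
  · rw [abs_of_nonpos h]
    have := Real.exp_pos s
    linarith

/-! ### A Hoffman bound for a box intersected with an affine subspace -/

section Hoffman

variable {ι V : Type*} [NormedAddCommGroup V] [NormedSpace ℝ V]

/-- A linear map without kernel on a closed cone is bounded below on it. -/
lemma exists_norm_le_mul_norm_of_cone [Fintype ι] (B : (ι → ℝ) →ₗ[ℝ] V) (K : Set (ι → ℝ))
    (hK : IsClosed K) (hs : ∀ c : ℝ, 0 ≤ c → ∀ v ∈ K, c • v ∈ K) (h0 : ∀ v ∈ K, B v = 0 → v = 0) :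
    ∃ κ : ℝ, 0 < κ ∧ ∀ v ∈ K, ‖v‖ ≤ κ * ‖B v‖ := by
  have hB : Continuous B := B.continuous_of_finiteDimensional
  have hc : IsCompact (Metric.sphere (0 : ι → ℝ) 1 ∩ K) := (isCompact_sphere _ _).inter_right hK
  have hmem : ∀ v ∈ K, v ≠ 0 → ‖v‖⁻¹ • v ∈ Metric.sphere (0 : ι → ℝ) 1 ∩ K := by
    intro v hv hv0
    refine ⟨?_, hs _ (by positivity) v hv⟩
    rw [mem_sphere_zero_iff_norm, norm_smul, norm_inv, norm_norm]
    exact inv_mul_cancel₀ (norm_ne_zero_iff.2 hv0)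
  rcases Set.eq_empty_or_nonempty (Metric.sphere (0 : ι → ℝ) 1 ∩ K) with he | hne
  · refine ⟨1, one_pos, fun v hv => ?_⟩
    by_cases hv0 : v = 0
    · simp [hv0]
    · have := hmem v hv hv0
      simp [he] at this
  · obtain ⟨w, hw, hmin⟩ := hc.exists_isMinOn hne (hB.norm.continuousOn)
    have hw0 : w ≠ 0 := by
      rintro rfl
      have := hw.1
      simp at this
    have hpos : 0 < ‖B w‖ := norm_pos_iff.2 fun h => hw0 (h0 w hw.2 h)
    refine ⟨‖B w‖⁻¹, by positivity, fun v hv => ?_⟩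
    by_cases hv0 : v = 0
    · simp [hv0]
    · have h1 : ‖B w‖ ≤ ‖B (‖v‖⁻¹ • v)‖ := hmin (hmem v hv hv0)
      have hvp : 0 < ‖v‖ := norm_pos_iff.2 hv0
      rw [map_smul, norm_smul, norm_inv, norm_norm, inv_mul_eq_div, le_div_iff₀ hvp] at h1
      rw [inv_mul_eq_div, le_div_iff₀ hpos]
      linarith

/-- The closed orthant of a sign pattern `σ`. -/
def signCone (σ : ι → SignType) : Set (ι → ℝ) :=
  {v | ∀ p, 0 ≤ (σ p : ℝ) * v p ∧ (σ p = 0 → v p = 0)}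

lemma isClosed_signCone (σ : ι → SignType) : IsClosed (signCone σ) := by
  have : signCone σ = ⋂ p, ({v : ι → ℝ | 0 ≤ (σ p : ℝ) * v p} ∩ {v | σ p = 0 → v p = 0}) := by
    ext v; simp [signCone]
  rw [this]
  refine isClosed_iInter fun p => IsClosed.inter ?_ ?_
  · exact isClosed_le continuous_const (by fun_prop)
  · by_cases h : σ p = 0
    · simp only [h, true_imp_iff]
      exact isClosed_eq (by fun_prop) continuous_const
    · simp [h]

lemma smul_mem_signCone {σ : ι → SignType} {c : ℝ} (hc : 0 ≤ c) {v : ι → ℝ}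
    (hv : v ∈ signCone σ) : c • v ∈ signCone σ := by
  intro p
  obtain ⟨h1, h2⟩ := hv p
  refine ⟨?_, fun h => by simp [h2 h]⟩
  rw [Pi.smul_apply, smul_eq_mul, mul_left_comm]
  exact mul_nonneg hc h1

/-- A vector `v₀` can be shrunk coordinatewise towards `0`, without changing its image under `B`,
until the kernel of `B` meets the orthant of its signs only in `0`: subtract a kernel vector
of maximal `ℓ¹` norm between `0` and `v₀`. -/
lemma exists_shrink [Fintype ι] (B : (ι → ℝ) →ₗ[ℝ] V) (v₀ : ι → ℝ) :
    ∃ v, B v = B v₀ ∧ (∀ p, v p ∈ Set.uIcc 0 (v₀ p)) ∧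
      ∀ u ∈ signCone (fun p => SignType.sign (v p)), B u = 0 → u = 0 := by
  have hB : Continuous B := B.continuous_of_finiteDimensional
  let F : Set (ι → ℝ) := Set.univ.pi (fun p => Set.uIcc 0 (v₀ p)) ∩ {w | B w = 0}
  have hF : IsCompact F := (isCompact_univ_pi fun p => isCompact_uIcc).inter_right
    (isClosed_eq hB continuous_const)
  have hne : F.Nonempty := ⟨0, fun p _ => Set.left_mem_uIcc, map_zero B⟩
  obtain ⟨w, ⟨hw1, hw2⟩, hmax⟩ := hF.exists_isMaxOn hne
    (f := fun w => ∑ p, |w p|) (by fun_prop)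
  have hw1 : ∀ p, w p ∈ Set.uIcc 0 (v₀ p) := fun p => hw1 p (Set.mem_univ p)
  have hw2 : B w = 0 := hw2
  have hcase : ∀ p, (0 ≤ w p ∧ w p ≤ v₀ p) ∨ (v₀ p ≤ w p ∧ w p ≤ 0) := fun p =>
    Set.mem_uIcc.1 (hw1 p)
  refine ⟨v₀ - w, by simp [hw2], fun p => ?_, fun u hu hBu => ?_⟩
  · rw [Set.mem_uIcc, Pi.sub_apply]
    rcases hcase p with h | h
    · left; constructor <;> linarith [h.1, h.2]
    · right; constructor <;> linarith [h.1, h.2]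
  · -- a kernel vector `u` in the orthant could be added to `w` in a small multiple `t`
    obtain ⟨t, ht0, ht⟩ : ∃ t : ℝ, 0 < t ∧ ∀ p, t * |u p| ≤ |v₀ p - w p| := by
      have : ∀ p, ∀ᶠ t in nhdsWithin (0 : ℝ) (Set.Ioi 0), t * |u p| ≤ |v₀ p - w p| := by
        intro p
        by_cases hp : v₀ p - w p = 0
        · have : u p = 0 := (hu p).2 (by simp [hp])
          simp [this]
        · have hpos : 0 * |u p| < |v₀ p - w p| := by simpa using hp
          have hc : Continuous fun t : ℝ => t * |u p| := by fun_prop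
          exact ((hc.tendsto 0).mono_left nhdsWithin_le_nhds).eventually_le_const hpos
      obtain ⟨t, h1, h2⟩ := ((Filter.eventually_all.2 this).and self_mem_nhdsWithin).exists
      exact ⟨t, h2, h1⟩
    have hsgn : ∀ p, (0 ≤ w p ∧ 0 ≤ u p ∧ w p + t * u p ≤ v₀ p) ∨
        (w p ≤ 0 ∧ u p ≤ 0 ∧ v₀ p ≤ w p + t * u p) := by
      intro p
      obtain ⟨h1, h2⟩ := hu p
      have h3 := ht p
      simp only [Pi.sub_apply] at h1 h2
      rcases lt_trichotomy (v₀ p - w p) 0 with h | h | h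
      · have hu0 : u p ≤ 0 := by
          rw [sign_neg h] at h1; simpa using h1
        right
        rw [abs_of_nonpos hu0, abs_of_neg h] at h3
        refine ⟨?_, hu0, by linarith⟩
        rcases hcase p with h' | h' <;> linarith
      · have hu0 : u p = 0 := h2 (by simp [h])
        rcases hcase p with h' | h'
        · left; simp [hu0, h'.1, h'.2]
        · right; simp [hu0, h'.1, h'.2]
      · have hu0 : 0 ≤ u p := by
          rw [sign_pos h] at h1; simpa using h1
        left
        rw [abs_of_nonneg hu0, abs_of_pos h] at h3
        refine ⟨?_, hu0, by linarith⟩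
        rcases hcase p with h' | h' <;> linarith
    have hmem : w + t • u ∈ F := by
      refine ⟨fun p _ => ?_, by simp [hw2, hBu]⟩
      rw [Set.mem_uIcc]
      simp only [Pi.add_apply, Pi.smul_apply, smul_eq_mul]
      rcases hsgn p with h | h
      · left; exact ⟨by nlinarith [mul_nonneg ht0.le h.2.1], h.2.2⟩
      · right; exact ⟨h.2.2, by nlinarith [mul_nonneg ht0.le (neg_nonneg.2 h.2.1)]⟩
    have habs : ∀ p, |(w + t • u) p| = |w p| + t * |u p| := by
      intro p
      simp only [Pi.add_apply, Pi.smul_apply, smul_eq_mul]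
      rcases hsgn p with h | h
      · rw [abs_of_nonneg h.1, abs_of_nonneg h.2.1,
          abs_of_nonneg (add_nonneg h.1 (mul_nonneg ht0.le h.2.1))]
      · rw [abs_of_nonpos h.1, abs_of_nonpos h.2.1, abs_of_nonpos (add_nonpos h.1
          (mul_nonpos_of_nonneg_of_nonpos ht0.le h.2.1))]
        ring
    have hle : ∑ p, |(w + t • u) p| ≤ ∑ p, |w p| := hmax hmem
    simp only [habs, Finset.sum_add_distrib, ← Finset.mul_sum] at hle
    have h0 : ∑ p, |u p| ≤ 0 := by nlinarith
    have h1 := (Finset.sum_eq_zero_iff_of_nonneg (fun p _ => abs_nonneg (u p))).1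
      (le_antisymm h0 (Finset.sum_nonneg fun p _ => abs_nonneg (u p)))
    funext p
    simpa using h1 p (Finset.mem_univ p)

/-- Every vector can be shrunk coordinatewise, keeping its image under `B`, to one whose norm is
controlled by that image, with a constant depending on `B` only. -/
lemma exists_shrink_norm_le [Fintype ι] (B : (ι → ℝ) →ₗ[ℝ] V) :
    ∃ κ : ℝ, 0 < κ ∧ ∀ v₀, ∃ v, B v = B v₀ ∧ (∀ p, v p ∈ Set.uIcc 0 (v₀ p)) ∧
      ‖v‖ ≤ κ * ‖B v₀‖ := by
  classical
  have h : ∀ σ : ι → SignType, ∃ κ : ℝ, 0 < κ ∧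
      ((∀ u ∈ signCone σ, B u = 0 → u = 0) → ∀ v ∈ signCone σ, ‖v‖ ≤ κ * ‖B v‖) := by
    intro σ
    by_cases hσ : ∀ u ∈ signCone σ, B u = 0 → u = 0
    · obtain ⟨κ, h1, h2⟩ := exists_norm_le_mul_norm_of_cone B (signCone σ) (isClosed_signCone σ)
        (fun c hc v hv => smul_mem_signCone hc hv) hσ
      exact ⟨κ, h1, fun _ => h2⟩
    · exact ⟨1, one_pos, fun h => absurd h hσ⟩
  choose κ hκ0 hκ using h
  refine ⟨∑ σ, κ σ, Finset.sum_pos (fun σ _ => hκ0 σ) Finset.univ_nonempty, fun v₀ => ?_⟩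
  obtain ⟨v, hv1, hv2, hv3⟩ := exists_shrink B v₀
  refine ⟨v, hv1, hv2, ?_⟩
  have hv4 : v ∈ signCone (fun p => SignType.sign (v p)) := fun p =>
    ⟨by rw [sign_mul_self]; exact abs_nonneg _, fun h => sign_eq_zero_iff.1 h⟩
  rw [← hv1]
  refine (hκ _ hv3 v hv4).trans (mul_le_mul_of_nonneg_right ?_ (norm_nonneg _))
  exact Finset.single_le_sum (f := κ) (fun σ _ => (hκ0 σ).le) (Finset.mem_univ _)

/-- Hoffman bound: a point of a box that nearly solves `B X = b` is close to a solution in the same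
box, which moreover keeps the active upper bounds active. The latter is possible because
a face of the box without solutions stays away from solving the equation, by compactness. -/
lemma exists_hoffman_box [Fintype ι] (B : (ι → ℝ) →ₗ[ℝ] V) (b : V) (lo up : ι → ℝ) :
    ∃ κ : ℝ, 0 < κ ∧ ∃ η : ℝ, 0 < η ∧ ∀ X ∈ Set.Icc lo up, ‖B X - b‖ ≤ η →
      ∃ Y ∈ Set.Icc lo up, B Y = b ∧ (∀ p, X p = up p → Y p = up p) ∧
        ‖Y - X‖ ≤ κ * ‖B X - b‖ := by
  classical
  have hB : Continuous B := B.continuous_of_finiteDimensional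
  obtain ⟨κ, hκ0, hκ⟩ := exists_shrink_norm_le B
  let F : Finset ι → Set (ι → ℝ) := fun J => Set.Icc lo up ∩ {X | ∀ p ∈ J, X p = up p}
  have hF : ∀ J, IsCompact (F J) := by
    intro J
    refine isCompact_Icc.inter_right ?_
    simp only [Set.ofPred_forall]
    exact isClosed_biInter fun p _ => isClosed_eq (by fun_prop) continuous_const
  have h : ∀ J : Finset ι, ∃ η : ℝ, 0 < η ∧
      ((∃ Z ∈ F J, B Z = b) ∨ ∀ X ∈ F J, η < ‖B X - b‖) := by
    intro J
    rcases (F J).eq_empty_or_nonempty with he | hne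
    · exact ⟨1, one_pos, Or.inr (by simp [he])⟩
    obtain ⟨Z, hZ, hmin⟩ := (hF J).exists_isMinOn hne
      (f := fun X => ‖B X - b‖) (by fun_prop)
    by_cases hZb : B Z = b
    · exact ⟨1, one_pos, Or.inl ⟨Z, hZ, hZb⟩⟩
    · have hpos : 0 < ‖B Z - b‖ := norm_pos_iff.2 (sub_ne_zero.2 hZb)
      refine ⟨‖B Z - b‖ / 2, by positivity, Or.inr fun X hX => ?_⟩
      have : ‖B Z - b‖ ≤ ‖B X - b‖ := hmin hX
      linarith
  choose η hη0 hη using h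
  obtain ⟨J₀, -, hJ₀⟩ := Finset.exists_min_image Finset.univ η Finset.univ_nonempty
  refine ⟨κ, hκ0, η J₀, hη0 J₀, fun X hX hXη => ?_⟩
  let J : Finset ι := Finset.univ.filter fun p => X p = up p
  have hXJ : X ∈ F J := ⟨hX, fun p hp => (Finset.mem_filter.1 hp).2⟩
  rcases hη J with ⟨Z, ⟨hZ, hZJ⟩, hZb⟩ | hno
  · obtain ⟨v, hv1, hv2, hv3⟩ := hκ (Z - X)
    have hbt : ∀ p, (X p ≤ X p + v p ∧ X p + v p ≤ Z p) ∨ (Z p ≤ X p + v p ∧ X p + v p ≤ X p) := by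
      intro p
      have := Set.mem_uIcc.1 (hv2 p)
      simp only [Pi.sub_apply] at this
      rcases this with h | h
      · left; constructor <;> linarith [h.1, h.2]
      · right; constructor <;> linarith [h.1, h.2]
    refine ⟨X + v, ⟨fun p => ?_, fun p => ?_⟩, ?_, fun p hp => ?_, ?_⟩
    · rw [Pi.add_apply]
      rcases hbt p with h | h
      · exact (hX.1 p).trans h.1
      · exact (hZ.1 p).trans h.1
    · rw [Pi.add_apply]
      rcases hbt p with h | h
      · exact h.2.trans (hZ.2 p)
      · exact h.2.trans (hX.2 p)
    · rw [map_add, hv1, map_sub, hZb]; abel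
    · rw [Pi.add_apply]
      have hZp : Z p = up p := hZJ p (Finset.mem_filter.2 ⟨Finset.mem_univ p, hp⟩)
      rcases hbt p with h | h <;> linarith [h.1, h.2]
    · rw [add_sub_cancel_left, norm_sub_rev, ← hZb, ← map_sub]
      exact hv3
  · exact absurd (hno X hXJ) (not_lt.2 (hXη.trans (hJ₀ J (Finset.mem_univ J))))

end Hoffman

variable {n₁ n₂ n₃ N : ℕ} {m : Fin N → ℕ}

/-! ### The dual objective on its domain -/

/-- The domain of `R`, as a condition on `W` alone. -/
def InDom (P : LPData n₁ n₂ n₃ N m) (W : Tensor n₁ n₂ n₃) : Prop :=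
  ∀ p, W p ≤ 0 ∧ (P.U p = ⊤ → W p = 0)

/-- The real value of `R` on its domain; an infinite bound `U p` contributes `0` through
`ENNReal.toReal ⊤ = 0`, in accordance with `W p = 0` there. -/
def dualVal (P : LPData n₁ n₂ n₃ N m) (S : Tensor n₁ n₂ n₃) (ε : ℝ)
    (y : Blocks m) (W : Tensor n₁ n₂ n₃) : ℝ :=
  ε * ∑ p, primalOf P S ε y W p - ∑ i, ∑ j, y i j * P.b i j - ∑ p, W p * (P.U p).toReal

variable {P : LPData n₁ n₂ n₃ N m} {S : Tensor n₁ n₂ n₃} {ε : ℝ}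

lemma primalOf_pos (y : Blocks m) (W : Tensor n₁ n₂ n₃) (p : Fin n₁ × Fin n₂ × Fin n₃) :
    0 < primalOf P S ε y W p :=
  Real.exp_pos _

lemma mul_log_primalOf (hε : 0 < ε) (y : Blocks m) (W : Tensor n₁ n₂ n₃)
    (p : Fin n₁ × Fin n₂ × Fin n₃) :
    ε * Real.log (primalOf P S ε y W p) = dualSum P y W p - Mten P S ε p := by
  unfold primalOf
  rw [Real.log_exp, mul_inv_cancel_left₀ hε.ne']

lemma primalOf_eq_mul_exp (y y' : Blocks m) (W W' : Tensor n₁ n₂ n₃)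
    (p : Fin n₁ × Fin n₂ × Fin n₃) :
    primalOf P S ε y W p =
      primalOf P S ε y' W' p * Real.exp (-(ε⁻¹ * (dualSum P y' W' p - dualSum P y W p))) := by
  unfold primalOf
  rw [← Real.exp_add]; congr 1; ring

lemma tinner_Mtilde (y : Blocks m) (W : Tensor n₁ n₂ n₃) :
    tinner (Mtilde P S ε) (fun p => Real.exp (ε⁻¹ * dualSum P y W p)) =
      ∑ p, primalOf P S ε y W p := by
  unfold tinner Mtilde primalOf
  refine Finset.sum_congr rfl fun p _ => ?_
  rw [← Real.exp_add]; congr 1; ring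

lemma R_of_inDom {W : Tensor n₁ n₂ n₃} (hW : InDom P W) (y : Blocks m) :
    R P S ε y W = ((dualVal P S ε y W : ℝ) : EReal) := by
  unfold R
  rw [if_pos fun p => (hW p).1, tinner_Mtilde]
  have h1 : (∑ p, ENNReal.ofReal (-(W p)) * P.U p : ℝ≥0∞) =
      ENNReal.ofReal (∑ p, -(W p) * (P.U p).toReal) := by
    rw [ENNReal.ofReal_sum_of_nonneg fun p _ =>
      mul_nonneg (neg_nonneg.2 (hW p).1) ENNReal.toReal_nonneg]
    refine Finset.sum_congr rfl fun p _ => ?_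
    by_cases hU : P.U p = ⊤
    · simp [(hW p).2 hU]
    · rw [ENNReal.ofReal_mul (neg_nonneg.2 (hW p).1), ENNReal.ofReal_toReal hU]
  have h2 : (0 : ℝ) ≤ ∑ p, -(W p) * (P.U p).toReal :=
    Finset.sum_nonneg fun p _ => mul_nonneg (neg_nonneg.2 (hW p).1) ENNReal.toReal_nonneg
  rw [h1, EReal.coe_ennreal_ofReal, max_eq_left h2, ← EReal.coe_add]
  congr 1
  unfold dualVal
  simp only [neg_mul, Finset.sum_neg_distrib]
  ring

lemma inDom_of_R_lt_top {y : Blocks m} {W : Tensor n₁ n₂ n₃} (h : R P S ε y W < ⊤) :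
    InDom P W := by
  by_cases hW : ∀ p, W p ≤ 0
  · refine fun p => ⟨hW p, fun hU => ?_⟩
    by_contra hp
    have hneg : W p < 0 := lt_of_le_of_ne (hW p) hp
    have htop : (∑ p, ENNReal.ofReal (-(W p)) * P.U p : ℝ≥0∞) = ⊤ := by
      rw [ENNReal.sum_eq_top]
      refine ⟨p, Finset.mem_univ p, ?_⟩
      rw [hU, ENNReal.mul_top]
      simpa using hneg
    unfold R at h
    rw [if_pos hW, htop, EReal.coe_ennreal_top, EReal.coe_add_top] at h
    exact lt_irrefl _ h
  · unfold R at h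
    rw [if_neg hW] at h
    exact absurd h (lt_irrefl _)

lemma R_eq_top {W : Tensor n₁ n₂ n₃} (hW : ¬ InDom P W) (y : Blocks m) : R P S ε y W = ⊤ := by
  by_contra h
  exact hW (inDom_of_R_lt_top (Ne.lt_top h))

lemma inDom_zero : InDom P (0 : Tensor n₁ n₂ n₃) := fun _ => ⟨le_rfl, fun _ => rfl⟩

/-- The adjoint relation, for all blocks together. -/
lemma sum_mul_Amap_add (y : Blocks m) (W X : Tensor n₁ n₂ n₃) :
    ∑ i, ∑ j, y i j * P.Amap i X j + ∑ p, W p * X p = ∑ p, dualSum P y W p * X p := by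
  unfold dualSum LPData.Aadj LPData.Amap tinner
  simp only [add_mul, Finset.sum_add_distrib, Finset.sum_mul, Finset.mul_sum]
  rw [add_comm]
  congr 1
  rw [Finset.sum_comm]
  refine Finset.sum_congr rfl fun i _ => ?_
  rw [Finset.sum_comm]
  simp only [mul_assoc]

/-- Exact second-order expansion of the dual objective: the difference of two values is a
curvature term plus the first-order terms at the second point. -/
lemma dualVal_sub_dualVal (hε : 0 < ε) (y y' : Blocks m) (W W' : Tensor n₁ n₂ n₃) :
    dualVal P S ε y W - dualVal P S ε y' W' =
      ε * ∑ p, primalOf P S ε y' W' p *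
        (Real.exp (-(ε⁻¹ * (dualSum P y' W' p - dualSum P y W p))) - 1 +
          ε⁻¹ * (dualSum P y' W' p - dualSum P y W p)) +
      ∑ i, ∑ j, (y i j - y' i j) * (P.Amap i (primalOf P S ε y' W') j - P.b i j) +
      ∑ p, (W p - W' p) * (primalOf P S ε y' W' p - (P.U p).toReal) := by
  have h1 := sum_mul_Amap_add (P := P) y W (primalOf P S ε y' W')
  have h2 := sum_mul_Amap_add (P := P) y' W' (primalOf P S ε y' W')
  have h3 : ε * ∑ p, primalOf P S ε y' W' p *
        (Real.exp (-(ε⁻¹ * (dualSum P y' W' p - dualSum P y W p))) - 1 +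
          ε⁻¹ * (dualSum P y' W' p - dualSum P y W p)) =
      ε * ∑ p, primalOf P S ε y W p - ε * ∑ p, primalOf P S ε y' W' p +
      (∑ p, dualSum P y' W' p * primalOf P S ε y' W' p -
        ∑ p, dualSum P y W p * primalOf P S ε y' W' p) := by
    simp only [Finset.mul_sum, ← Finset.sum_sub_distrib, ← Finset.sum_add_distrib]
    refine Finset.sum_congr rfl fun p _ => ?_
    rw [primalOf_eq_mul_exp y y' W W' p]
    field_simp
  rw [h3]
  simp only [sub_mul, mul_sub, Finset.sum_sub_distrib]
  unfold dualVal
  linarith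

/-! ### Duality -/

/-- The primal objective on nonnegative tensors, up to an additive constant. -/
def entropicCost (P : LPData n₁ n₂ n₃ N m) (S : Tensor n₁ n₂ n₃) (ε : ℝ)
    (X : Tensor n₁ n₂ n₃) : ℝ :=
  ∑ p, (ε * (X p * Real.log (X p) - X p) + Mten P S ε p * X p)

/-- The duality gap at `X` and `(y, W)` is a relative entropy plus a complementarity term. -/
lemma dualVal_add_entropicCost (hε : 0 < ε) {X : Tensor n₁ n₂ n₃} (hX : ∀ i, P.Amap i X = P.b i)
    (y : Blocks m) (W : Tensor n₁ n₂ n₃) :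
    dualVal P S ε y W + entropicCost P S ε X =
      ε * ∑ p, relEnt (X p) (primalOf P S ε y W p) + ∑ p, -W p * ((P.U p).toReal - X p) := by
  have h1 := sum_mul_Amap_add (P := P) y W X
  simp only [hX] at h1
  have h2 : ε * ∑ p, relEnt (X p) (primalOf P S ε y W p) = entropicCost P S ε X +
      ε * ∑ p, primalOf P S ε y W p - ∑ p, dualSum P y W p * X p := by
    unfold entropicCost
    simp only [Finset.mul_sum, ← Finset.sum_sub_distrib, ← Finset.sum_add_distrib]
    refine Finset.sum_congr rfl fun p _ => ?_
    have := mul_log_primalOf (P := P) (S := S) hε y W p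
    unfold relEnt
    linear_combination (-X p) * this
  rw [h2, ← h1]
  unfold dualVal
  simp only [neg_mul, mul_sub, Finset.sum_sub_distrib, Finset.sum_neg_distrib]
  ring

lemma coe_le_U_iff {x : ℝ} {u : ℝ≥0∞} :
    ((x : ℝ) : EReal) ≤ ((u : ℝ≥0∞) : EReal) ↔ (u ≠ ⊤ → x ≤ u.toReal) := by
  by_cases h : u = ⊤
  · simp [h]
  · rw [← EReal.coe_toReal (x := (u : EReal)) (by simpa using h) (by simp), EReal.coe_le_coe_iff]
    simp [h]

lemma neg_mul_U_sub_nonneg {X W : Tensor n₁ n₂ n₃} (hX : X ∈ P.OmegaCirc) (hW : InDom P W)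
    (p : Fin n₁ × Fin n₂ × Fin n₃) : 0 ≤ -W p * ((P.U p).toReal - X p) := by
  by_cases hU : P.U p = ⊤
  · simp [(hW p).2 hU]
  · exact mul_nonneg (neg_nonneg.2 (hW p).1) (sub_nonneg.2 (coe_le_U_iff.1 (hX.2 p) hU))

/-- The Karush–Kuhn–Tucker conditions of the pair of problems, in terms of the dual point. -/
structure IsKKT (P : LPData n₁ n₂ n₃ N m) (S : Tensor n₁ n₂ n₃) (ε : ℝ)
    (y : Blocks m) (W : Tensor n₁ n₂ n₃) : Prop where
  inDom : InDom P W
  mem : primalOf P S ε y W ∈ P.OmegaCirc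
  slack : ∀ p, W p * ((P.U p).toReal - primalOf P S ε y W p) = 0

lemma IsKKT.isDualOptimal (hε : 0 < ε) {y : Blocks m} {W : Tensor n₁ n₂ n₃}
    (h : IsKKT P S ε y W) : IsDualOptimal P S ε y W := by
  intro y' W'
  by_cases hW' : InDom P W'
  · rw [R_of_inDom h.inDom, R_of_inDom hW', EReal.coe_le_coe_iff, ← sub_nonneg,
      dualVal_sub_dualVal hε]
    have h1 : ∑ i, ∑ j, (y' i j - y i j) * (P.Amap i (primalOf P S ε y W) j - P.b i j) = 0 :=
      Finset.sum_eq_zero fun i _ => Finset.sum_eq_zero fun j _ => by rw [h.mem.1 i]; ring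
    rw [h1, add_zero]
    refine add_nonneg (mul_nonneg hε.le (Finset.sum_nonneg fun p _ => mul_nonneg
      (primalOf_pos y W p).le (exp_neg_sub_nonneg _))) (Finset.sum_nonneg fun p _ => ?_)
    have h2 := h.slack p
    have h3 := neg_mul_U_sub_nonneg h.mem hW' p
    nlinarith
  · rw [R_eq_top hW']; exact le_top

lemma primalObj_of_nonneg {X : Tensor n₁ n₂ n₃} (hS : ∀ p, 0 < S p) (hX : ∀ p, 0 ≤ X p) :
    primalObj P S ε X = ((entropicCost P S ε X + ε * ∑ p, S p : ℝ) : EReal) := by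
  unfold primalObj bregman entropy
  rw [if_pos hX, if_pos fun p => (hS p).le]
  norm_cast
  unfold entropicCost tinner Mten
  simp only [Finset.mul_sum, ← Finset.sum_sub_distrib, ← Finset.sum_add_distrib, Pi.sub_apply]
  refine Finset.sum_congr rfl fun p _ => ?_
  ring

lemma primalObj_of_not_nonneg {X : Tensor n₁ n₂ n₃} (hε : 0 < ε) (hS : ∀ p, 0 < S p)
    (hX : ¬ ∀ p, 0 ≤ X p) : primalObj P S ε X = ⊤ := by
  unfold primalObj bregman entropy
  rw [if_neg hX, if_pos fun p => (hS p).le, EReal.top_sub_coe, EReal.top_sub_coe,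
    EReal.coe_mul_top_of_pos hε, EReal.coe_add_top]

/-- The gap of a feasible nonnegative `X` to the primal tensor of a KKT point. -/
lemma IsKKT.entropicCost_sub (hε : 0 < ε) {y : Blocks m} {W X : Tensor n₁ n₂ n₃}
    (h : IsKKT P S ε y W) (hX : X ∈ P.OmegaCirc) :
    entropicCost P S ε (primalOf P S ε y W) + ε * ∑ p, relEnt (X p) (primalOf P S ε y W p) ≤
      entropicCost P S ε X := by
  have h1 := dualVal_add_entropicCost (S := S) hε h.mem.1 y W
  have h2 := dualVal_add_entropicCost (S := S) hε hX.1 y W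
  have h3 : ∑ p, -W p * ((P.U p).toReal - primalOf P S ε y W p) = 0 :=
    Finset.sum_eq_zero fun p _ => by rw [neg_mul, h.slack p, neg_zero]
  simp only [relEnt_self, Finset.sum_const_zero, mul_zero, h3, add_zero] at h1
  have h4 : 0 ≤ ∑ p, -W p * ((P.U p).toReal - X p) :=
    Finset.sum_nonneg fun p _ => neg_mul_U_sub_nonneg hX h.inDom p
  linarith

lemma IsKKT.isPrimalOptimal (hε : 0 < ε) (hS : ∀ p, 0 < S p) {y : Blocks m}
    {W : Tensor n₁ n₂ n₃} (h : IsKKT P S ε y W) :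
    IsPrimalOptimal P S ε (primalOf P S ε y W) := by
  refine ⟨h.mem, fun X hX => ?_⟩
  show primalObj P S ε _ ≤ primalObj P S ε X
  by_cases hX0 : ∀ p, 0 ≤ X p
  · rw [primalObj_of_nonneg hS hX0, primalObj_of_nonneg hS fun p => (primalOf_pos y W p).le,
      EReal.coe_le_coe_iff]
    have h1 := h.entropicCost_sub hε hX
    have h2 : 0 ≤ ε * ∑ p, relEnt (X p) (primalOf P S ε y W p) := mul_nonneg hε.le
      (Finset.sum_nonneg fun p _ => relEnt_nonneg (hX0 p) (primalOf_pos y W p))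
    linarith
  · rw [primalObj_of_not_nonneg hε hS hX0]; exact le_top

lemma IsKKT.eq_of_isPrimalOptimal (hε : 0 < ε) (hS : ∀ p, 0 < S p) {y : Blocks m}
    {W X : Tensor n₁ n₂ n₃} (h : IsKKT P S ε y W) (hX : IsPrimalOptimal P S ε X) :
    X = primalOf P S ε y W := by
  have hle : primalObj P S ε X ≤ primalObj P S ε (primalOf P S ε y W) := hX.2 h.mem
  rw [primalObj_of_nonneg hS fun p => (primalOf_pos y W p).le] at hle
  by_cases hX0 : ∀ p, 0 ≤ X p
  · rw [primalObj_of_nonneg hS hX0, EReal.coe_le_coe_iff] at hle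
    have h1 := h.entropicCost_sub hε hX.1
    have h2 : ∑ p, relEnt (X p) (primalOf P S ε y W p) ≤ 0 := by
      by_contra hcon
      have := mul_pos hε (not_le.1 hcon)
      linarith
    have h3 : ∀ p ∈ Finset.univ, 0 ≤ relEnt (X p) (primalOf P S ε y W p) :=
      fun p _ => relEnt_nonneg (hX0 p) (primalOf_pos y W p)
    have h4 := (Finset.sum_eq_zero_iff_of_nonneg h3).1 (le_antisymm h2 (Finset.sum_nonneg h3))
    funext p
    exact eq_of_relEnt_eq_zero (hX0 p) (primalOf_pos y W p) (h4 p (Finset.mem_univ p))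
  · rw [primalObj_of_not_nonneg hε hS hX0] at hle
    exact absurd hle (not_le.2 (EReal.coe_lt_top _))

/-! ### Optimality conditions of the block minimizations -/

lemma dualSum_sub_of_forall_ne {y y' : Blocks m} {i : Fin N} (h : ∀ k, k ≠ i → y k = y' k)
    (W : Tensor n₁ n₂ n₃) (p : Fin n₁ × Fin n₂ × Fin n₃) :
    dualSum P y W p - dualSum P y' W p = ∑ j, (y i j - y' i j) * P.A i j p := by
  unfold dualSum
  rw [add_sub_add_left_eq_sub, ← Finset.sum_sub_distrib, Finset.sum_eq_single i]
  · unfold LPData.Aadj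
    simp only [sub_mul, Finset.sum_sub_distrib]
  · intro k _ hk
    rw [h k hk, sub_self]
  · simp

lemma dualSum_sub_of_W (y : Blocks m) (W W' : Tensor n₁ n₂ n₃) (p : Fin n₁ × Fin n₂ × Fin n₃) :
    dualSum P y W p - dualSum P y W' p = W p - W' p := by
  unfold dualSum; ring

/-- A minimizer over one block `y i` satisfies the constraints of that block. -/
lemma Amap_eq_of_isMin (hA : P.NonOverlapping) (hε : 0 < ε) {y : Blocks m} {W : Tensor n₁ n₂ n₃}
    {i : Fin N}
    (hmin : ∀ v, dualVal P S ε y W ≤ dualVal P S ε (Function.update y i v) W) :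
    P.Amap i (primalOf P S ε y W) = P.b i := by
  classical
  funext j
  set X := primalOf P S ε y W with hX
  have key : ∀ t : ℝ, t * P.b i j ≤ P.Amap i X j * (Real.exp t - 1) := by
    intro t
    have h1 := hmin (y i + Pi.single j (ε * t))
    set y' := Function.update y i (y i + Pi.single j (ε * t)) with hy'
    have hT : ∀ p, dualSum P y W p - dualSum P y' W p = -(ε * t * P.A i j p) := by
      intro p
      rw [← neg_sub, dualSum_sub_of_forall_ne (i := i) fun k hk => by
        rw [hy', Function.update_of_ne hk]]
      rw [Finset.sum_eq_single j]
      · simp [hy']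
      · intro k _ hk
        simp [hy', hk]
      · simp
    have h2 := dualVal_sub_dualVal (P := P) (S := S) hε y' y W W
    have h3 : ∑ k, ∑ l, (y' k l - y k l) * (P.Amap k X l - P.b k l) =
        ε * t * (P.Amap i X j - P.b i j) := by
      rw [Finset.sum_eq_single i, Finset.sum_eq_single j]
      · simp [hy']
      · intro l _ hl
        simp [hy', hl]
      · simp
      · intro k _ hk
        simp [hy', Function.update_of_ne hk]
      · simp
    have h4 : ∑ p, X p * (Real.exp (-(ε⁻¹ * (dualSum P y W p - dualSum P y' W p))) - 1 +
        ε⁻¹ * (dualSum P y W p - dualSum P y' W p)) =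
        P.Amap i X j * (Real.exp t - 1 - t) := by
      unfold LPData.Amap tinner
      rw [Finset.sum_mul]
      refine Finset.sum_congr rfl fun p _ => ?_
      have h5 : ε⁻¹ * -(ε * t * P.A i j p) = -(t * P.A i j p) := by field_simp
      rw [hT, h5]
      rcases hA.1 i j p with h | h <;> simp only [h]
      · simp
      · rw [mul_one, neg_neg]; ring
    rw [← hX, h3, h4] at h2
    simp only [sub_self, zero_mul, Finset.sum_const_zero, add_zero] at h2
    have h6 : 0 ≤ ε * (P.Amap i X j * (Real.exp t - 1 - t) + t * (P.Amap i X j - P.b i j)) := by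
      linarith
    have h7 := nonneg_of_mul_nonneg_right h6 hε
    linarith
  have h0 : 0 ≤ P.Amap i X j := by
    unfold LPData.Amap tinner
    refine Finset.sum_nonneg fun p _ => mul_nonneg ?_ (primalOf_pos y W p).le
    rcases hA.1 i j p with h | h <;> simp [h]
  refine le_antisymm (le_of_forall_mul_one_sub_exp_le h0 fun t _ => ?_)
    (le_of_forall_le_mul_exp_sub_one one_pos h0 fun t _ _ => key t)
  have := key (-t)
  linarith

/-- Optimality conditions of the minimization over `W`: the bound `X ≤ U` and complementarity. -/
lemma le_U_and_slack_of_isMin (hε : 0 < ε) {y : Blocks m} {W : Tensor n₁ n₂ n₃}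
    (hW : InDom P W) (hmin : ∀ V, InDom P V → dualVal P S ε y W ≤ dualVal P S ε y V)
    (p : Fin n₁ × Fin n₂ × Fin n₃) :
    (P.U p ≠ ⊤ → primalOf P S ε y W p ≤ (P.U p).toReal) ∧
      W p * ((P.U p).toReal - primalOf P S ε y W p) = 0 := by
  classical
  by_cases hU : P.U p = ⊤
  · exact ⟨fun h => absurd hU h, by rw [(hW p).2 hU, zero_mul]⟩
  set X := primalOf P S ε y W with hX
  set u := (P.U p).toReal
  have key : ∀ t : ℝ, W p + ε * t ≤ 0 → t * u ≤ X p * (Real.exp t - 1) := by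
    intro t ht
    set V := W + Pi.single p (ε * t) with hV
    have hVdom : InDom P V := by
      intro q
      by_cases hq : q = p
      · subst hq
        exact ⟨by simpa [hV] using ht, fun h => absurd h hU⟩
      · simpa [hV, hq] using hW q
    have h1 := hmin V hVdom
    have h2 := dualVal_sub_dualVal (P := P) (S := S) hε y y V W
    simp only [dualSum_sub_of_W, sub_self, zero_mul, Finset.sum_const_zero, add_zero] at h2
    rw [Finset.sum_eq_single p, Finset.sum_eq_single p] at h2
    · have h5 : ε⁻¹ * (W p - V p) = -t := by
        simp only [hV, Pi.add_apply, Pi.single_eq_same]; field_simp; ring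
      have h6 : V p - W p = ε * t := by simp [hV]
      rw [h5, h6, neg_neg, ← hX] at h2
      have h7 : 0 ≤ ε * (X p * (Real.exp t - 1 + -t) + t * (X p - u)) := by linarith
      have h8 := nonneg_of_mul_nonneg_right h7 hε
      linarith
    · intro q _ hq
      simp [hV, hq]
    · simp
    · intro q _ hq
      simp [hV, hq]
    · simp
  have h0 : 0 ≤ X p := (primalOf_pos y W p).le
  have hle : X p ≤ u := by
    refine le_of_forall_mul_one_sub_exp_le h0 fun t ht => ?_
    have := key (-t) (by nlinarith [(hW p).1, mul_pos hε ht])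
    linarith
  refine ⟨fun _ => hle, ?_⟩
  rcases (hW p).1.eq_or_lt with h | h
  · rw [h, zero_mul]
  · have hge : u ≤ X p := by
      refine le_of_forall_le_mul_exp_sub_one (η := -W p / ε) (div_pos (neg_pos.2 h) hε) h0
        fun t _ ht => key t ?_
      rw [lt_div_iff₀ hε] at ht
      linarith
    rw [le_antisymm hle hge, sub_self, mul_zero]

/-! ### A priori bounds on sublevel sets -/

lemma neg_entropicCost_le_dualVal (hε : 0 < ε) {X : Tensor n₁ n₂ n₃} (hX : X ∈ P.Omega)
    (y : Blocks m) {W : Tensor n₁ n₂ n₃} (hW : InDom P W) :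
    -entropicCost P S ε X ≤ dualVal P S ε y W := by
  have h1 := dualVal_add_entropicCost (S := S) hε hX.1.1 y W
  have h2 : 0 ≤ ∑ p, -W p * ((P.U p).toReal - X p) :=
    Finset.sum_nonneg fun p _ => neg_mul_U_sub_nonneg hX.1 hW p
  have h3 : 0 ≤ ε * ∑ p, relEnt (X p) (primalOf P S ε y W p) := mul_nonneg hε.le
    (Finset.sum_nonneg fun p _ => relEnt_nonneg (hX.2 p) (primalOf_pos y W p))
  linarith

/-- On the sublevel set of the dual objective at level `V`, the primal tensors have entries in
`[exp (-D), exp D]`. -/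
def BoundedLog (P : LPData n₁ n₂ n₃ N m) (S : Tensor n₁ n₂ n₃) (ε V D : ℝ) : Prop :=
  ∀ (y : Blocks m) (W : Tensor n₁ n₂ n₃), InDom P W →
    dualVal P S ε y W ≤ V → ∀ p, |Real.log (primalOf P S ε y W p)| ≤ D

/-- On a sublevel set of the dual objective the primal tensors are bounded above and bounded away
from zero, although the dual variables need not be bounded: a positive feasible tensor makes
the duality gap coercive in `log X`. -/
lemma exists_boundedLog (hΩ : P.Feasible) (hε : 0 < ε) (V : ℝ) :
    ∃ D : ℝ, 0 ≤ D ∧ BoundedLog P S ε V D := by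
  obtain ⟨-, X, hX, hpos⟩ := hΩ
  set K := (V + entropicCost P S ε X) / ε with hK
  refine ⟨∑ p, (|Real.log (X p)| + |K| / X p + 1), Finset.sum_nonneg fun p _ => ?_,
    fun y W hW hV p => ?_⟩
  · have := hpos p; positivity
  have h1 := dualVal_add_entropicCost (S := S) hε hX.1.1 y W
  have h2 : 0 ≤ ∑ p, -W p * ((P.U p).toReal - X p) :=
    Finset.sum_nonneg fun p _ => neg_mul_U_sub_nonneg hX.1 hW p
  have h3 : ∑ p, relEnt (X p) (primalOf P S ε y W p) ≤ K := by
    rw [hK, le_div_iff₀ hε]; linarith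
  have h4 : relEnt (X p) (primalOf P S ε y W p) ≤ |K| :=
    (Finset.single_le_sum (f := fun p => relEnt (X p) (primalOf P S ε y W p))
      (fun p _ => relEnt_nonneg (hX.2 p) (primalOf_pos y W p)) (Finset.mem_univ p)).trans
      (h3.trans (le_abs_self K))
  have h5 := abs_log_sub_log_le (hpos p) (primalOf_pos (P := P) (S := S) (ε := ε) y W p)
  have h6 : relEnt (X p) (primalOf P S ε y W p) / X p ≤ |K| / X p :=
    div_le_div_of_nonneg_right h4 (hpos p).le
  have h7 : |Real.log (primalOf P S ε y W p)| ≤ |Real.log (X p)| + |K| / X p + 1 := by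
    have := abs_sub_abs_le_abs_sub (Real.log (primalOf P S ε y W p)) (Real.log (X p))
    linarith
  refine h7.trans (Finset.single_le_sum (f := fun p => |Real.log (X p)| + |K| / X p + 1)
    (fun q _ => ?_) (Finset.mem_univ p))
  have := hpos q; positivity

lemma primalOf_le_exp {D : ℝ} {y : Blocks m} {W : Tensor n₁ n₂ n₃}
    {p : Fin n₁ × Fin n₂ × Fin n₃} (h : |Real.log (primalOf P S ε y W p)| ≤ D) :
    primalOf P S ε y W p ≤ Real.exp D := by
  rw [← Real.exp_log (primalOf_pos (P := P) (S := S) (ε := ε) y W p)]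
  exact Real.exp_le_exp.2 ((le_abs_self _).trans h)

lemma exp_neg_le_primalOf {D : ℝ} {y : Blocks m} {W : Tensor n₁ n₂ n₃}
    {p : Fin n₁ × Fin n₂ × Fin n₃} (h : |Real.log (primalOf P S ε y W p)| ≤ D) :
    Real.exp (-D) ≤ primalOf P S ε y W p := by
  rw [← Real.exp_log (primalOf_pos (P := P) (S := S) (ε := ε) y W p)]
  exact Real.exp_le_exp.2 (neg_le_of_abs_le h)

lemma abs_primalOf_sub_le (hε : 0 < ε) {B : ℝ} {y y' : Blocks m} {W W' : Tensor n₁ n₂ n₃}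
    {p : Fin n₁ × Fin n₂ × Fin n₃} (h : primalOf P S ε y W p ≤ B)
    (h' : primalOf P S ε y' W' p ≤ B) :
    |primalOf P S ε y W p - primalOf P S ε y' W' p| ≤
      B * (ε⁻¹ * |dualSum P y W p - dualSum P y' W' p|) := by
  refine (abs_exp_sub_exp_le h h').trans (le_of_eq ?_)
  rw [← mul_sub, abs_mul, abs_of_pos (inv_pos.2 hε)]
  ring_nf

/-! ### One cycle of the method -/

/-- The modulus of sufficient descent on the set where `|log X| ≤ D`. -/
def descentConst (ε D : ℝ) : ℝ := ε * Real.exp (-D) * (1 / (2 * (2 * D + 2))) * ε⁻¹ ^ 2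

lemma descentConst_pos {D : ℝ} (hε : 0 < ε) (hD : 0 ≤ D) : 0 < descentConst ε D := by
  unfold descentConst; positivity

/-- If the first-order terms at the second point are nonnegative, the dual objective decreases at
least quadratically in the change of `dualSum`. -/
lemma sq_dualSum_sub_le (hε : 0 < ε) {D : ℝ} (hD : 0 ≤ D) {y y' : Blocks m}
    {W W' : Tensor n₁ n₂ n₃}
    (hX : ∀ p, |Real.log (primalOf P S ε y W p)| ≤ D)
    (hX' : ∀ p, |Real.log (primalOf P S ε y' W' p)| ≤ D)
    (h1 : ∀ i j, 0 ≤ (y i j - y' i j) * (P.Amap i (primalOf P S ε y' W') j - P.b i j))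
    (h2 : ∀ p, 0 ≤ (W p - W' p) * (primalOf P S ε y' W' p - (P.U p).toReal))
    (p : Fin n₁ × Fin n₂ × Fin n₃) :
    descentConst ε D * (dualSum P y' W' p - dualSum P y W p) ^ 2 ≤
      dualVal P S ε y W - dualVal P S ε y' W' := by
  rw [dualVal_sub_dualVal hε]
  have hlog : ε⁻¹ * (dualSum P y' W' p - dualSum P y W p) =
      Real.log (primalOf P S ε y' W' p) - Real.log (primalOf P S ε y W p) := by
    have e1 := mul_log_primalOf (P := P) (S := S) hε y W p
    have e2 := mul_log_primalOf (P := P) (S := S) hε y' W' p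
    rw [inv_mul_eq_iff_eq_mul₀ hε.ne']
    linarith
  have hτ : |ε⁻¹ * (dualSum P y' W' p - dualSum P y W p)| ≤ 2 * D := by
    rw [hlog]
    have := abs_sub (Real.log (primalOf P S ε y' W' p)) (Real.log (primalOf P S ε y W p))
    linarith [hX p, hX' p]
  have h3 : ∀ q, 0 ≤ primalOf P S ε y' W' q *
        (Real.exp (-(ε⁻¹ * (dualSum P y' W' q - dualSum P y W q))) - 1 +
          ε⁻¹ * (dualSum P y' W' q - dualSum P y W q)) := fun q =>
    mul_nonneg (primalOf_pos _ _ q).le (exp_neg_sub_nonneg _)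
  have h4 := Finset.single_le_sum (fun q _ => h3 q) (Finset.mem_univ p)
  have h5 : Real.exp (-D) * (1 / (2 * (2 * D + 2)) *
      (ε⁻¹ * (dualSum P y' W' p - dualSum P y W p)) ^ 2) ≤ primalOf P S ε y' W' p *
        (Real.exp (-(ε⁻¹ * (dualSum P y' W' p - dualSum P y W p))) - 1 +
          ε⁻¹ * (dualSum P y' W' p - dualSum P y W p)) :=
    mul_le_mul (exp_neg_le_primalOf (hX' p)) (sq_le_exp_neg_sub hτ) (by positivity)
      (primalOf_pos _ _ p).le
  have h6 := mul_le_mul_of_nonneg_left (h5.trans h4) hε.le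
  have h7 : 0 ≤ ∑ i, ∑ j, (y i j - y' i j) * (P.Amap i (primalOf P S ε y' W') j - P.b i j) :=
    Finset.sum_nonneg fun i _ => Finset.sum_nonneg fun j _ => h1 i j
  have h8 : 0 ≤ ∑ p, (W p - W' p) * (primalOf P S ε y' W' p - (P.U p).toReal) :=
    Finset.sum_nonneg fun p _ => h2 p
  have h9 : descentConst ε D * (dualSum P y' W' p - dualSum P y W p) ^ 2 =
      ε * (Real.exp (-D) * (1 / (2 * (2 * D + 2)) *
      (ε⁻¹ * (dualSum P y' W' p - dualSum P y W p)) ^ 2)) := by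
    unfold descentConst; ring
  rw [h9]
  linarith

/-- The multipliers in the course of a cycle from `y` to `y'`, after the first `s` blocks have been
updated. -/
def partialSweep (y y' : Blocks m) (s : ℕ) : Blocks m := fun k => if (k : ℕ) < s then y' k else y k

lemma partialSweep_zero (y y' : Blocks m) : partialSweep y y' 0 = y := by
  funext k; simp [partialSweep]

lemma partialSweep_last (y y' : Blocks m) : partialSweep y y' N = y' := by
  funext k; simp [partialSweep]

lemma cyclicArg_old (y y' : Blocks m) (i : Fin N) :
    cyclicArg y' y i (y i) = partialSweep y y' i := by
  funext k
  unfold cyclicArg partialSweep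
  by_cases hk : k = i
  · subst hk; simp
  · simp only [Function.update_of_ne hk, Fin.lt_def]

lemma cyclicArg_new (y y' : Blocks m) (i : Fin N) :
    cyclicArg y' y i (y' i) = partialSweep y y' (i + 1) := by
  funext k
  unfold cyclicArg partialSweep
  by_cases hk : k = i
  · subst hk; simp
  · have : ((k : ℕ) < i + 1) ↔ (k : ℕ) < i := by
      have : (k : ℕ) ≠ i := fun h => hk (Fin.ext h)
      omega
    simp only [Function.update_of_ne hk, Fin.lt_def, this]

lemma update_cyclicArg (y y' : Blocks m) (i : Fin N) (v w : Fin (m i) → ℝ) :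
    Function.update (cyclicArg y' y i w) i v = cyclicArg y' y i v := by
  unfold cyclicArg; rw [Function.update_idem]

/-- `(y', W')` is obtained from `(y, W)` by one cycle of block minimizations. -/
structure IsCycle (P : LPData n₁ n₂ n₃ N m) (S : Tensor n₁ n₂ n₃) (ε : ℝ)
    (y : Blocks m) (W : Tensor n₁ n₂ n₃) (y' : Blocks m) (W' : Tensor n₁ n₂ n₃) : Prop where
  inDom : InDom P W
  inDom' : InDom P W'
  min_y : ∀ (i : Fin N) (v : Fin (m i) → ℝ),
    dualVal P S ε (partialSweep y y' (i + 1)) W ≤ dualVal P S ε (cyclicArg y' y i v) W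
  min_W : ∀ V, InDom P V → dualVal P S ε y' W' ≤ dualVal P S ε y' V

lemma isCycle_of_isMinOn {y y' : Blocks m} {W W' : Tensor n₁ n₂ n₃} (hW : InDom P W)
    (hy : ∀ i : Fin N, IsMinOn (fun v => R P S ε (cyclicArg y' y i v) W) Set.univ (y' i))
    (hmin : IsMinOn (fun V => R P S ε y' V) Set.univ W') : IsCycle P S ε y W y' W' := by
  have hW' : InDom P W' := by
    have h : R P S ε y' W' ≤ R P S ε y' 0 := hmin (Set.mem_univ _)
    rw [R_of_inDom inDom_zero] at h
    exact inDom_of_R_lt_top (h.trans_lt (EReal.coe_lt_top _))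
  refine ⟨hW, hW', fun i v => ?_, fun V hV => ?_⟩
  · have h : R P S ε (cyclicArg y' y i (y' i)) W ≤ R P S ε (cyclicArg y' y i v) W :=
      hy i (Set.mem_univ v)
    rwa [R_of_inDom hW, R_of_inDom hW, EReal.coe_le_coe_iff, cyclicArg_new] at h
  · have h : R P S ε y' W' ≤ R P S ε y' V := hmin (Set.mem_univ V)
    rwa [R_of_inDom hW', R_of_inDom hV, EReal.coe_le_coe_iff] at h

namespace IsCycle

variable {y y' : Blocks m} {W W' : Tensor n₁ n₂ n₃}

lemma dualVal_partialSweep_anti (h : IsCycle P S ε y W y' W') {s t : ℕ} (hst : s ≤ t) :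
    t ≤ N → dualVal P S ε (partialSweep y y' t) W ≤ dualVal P S ε (partialSweep y y' s) W := by
  induction t, hst using Nat.le_induction with
  | base => exact fun _ => le_rfl
  | succ t _ ih =>
    intro ht
    have h1 := h.min_y ⟨t, ht⟩ (y ⟨t, ht⟩)
    rw [cyclicArg_old] at h1
    exact h1.trans (ih (by omega))

lemma dualVal_sweep_le (h : IsCycle P S ε y W y' W') {s : ℕ} (hs : s ≤ N) :
    dualVal P S ε (partialSweep y y' s) W ≤ dualVal P S ε y W := by
  have := h.dualVal_partialSweep_anti (Nat.zero_le s) hs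
  rwa [partialSweep_zero] at this

lemma dualVal_mid_le_sweep (h : IsCycle P S ε y W y' W') {s : ℕ} (hs : s ≤ N) :
    dualVal P S ε y' W ≤ dualVal P S ε (partialSweep y y' s) W := by
  have := h.dualVal_partialSweep_anti hs le_rfl
  rwa [partialSweep_last] at this

lemma dualVal_le_mid (h : IsCycle P S ε y W y' W') :
    dualVal P S ε y' W' ≤ dualVal P S ε y' W := h.min_W W h.inDom

lemma dualVal_le (h : IsCycle P S ε y W y' W') : dualVal P S ε y' W' ≤ dualVal P S ε y W := by
  have := h.dualVal_mid_le_sweep (Nat.zero_le N)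
  rw [partialSweep_zero] at this
  exact h.dualVal_le_mid.trans this

lemma Amap_partialSweep (h : IsCycle P S ε y W y' W') (hA : P.NonOverlapping) (hε : 0 < ε)
    (i : Fin N) : P.Amap i (primalOf P S ε (partialSweep y y' (i + 1)) W) = P.b i := by
  refine Amap_eq_of_isMin hA hε fun v => ?_
  have := h.min_y i v
  rwa [← update_cyclicArg y y' i v (y' i), cyclicArg_new] at this

lemma le_U_and_slack (h : IsCycle P S ε y W y' W') (hε : 0 < ε)
    (p : Fin n₁ × Fin n₂ × Fin n₃) :
    (P.U p ≠ ⊤ → primalOf P S ε y' W' p ≤ (P.U p).toReal) ∧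
      W' p * ((P.U p).toReal - primalOf P S ε y' W' p) = 0 :=
  le_U_and_slack_of_isMin hε h.inDom' h.min_W p

variable {D V : ℝ}

/-- The bound on the steps of a cycle that sufficient descent with modulus `descentConst ε D` gives
from the decrease of the dual objective. -/
def stepSize (P : LPData n₁ n₂ n₃ N m) (S : Tensor n₁ n₂ n₃) (ε D : ℝ) (y : Blocks m)
    (W : Tensor n₁ n₂ n₃) (y' : Blocks m) (W' : Tensor n₁ n₂ n₃) : ℝ :=
  Real.sqrt ((dualVal P S ε y W - dualVal P S ε y' W') / descentConst ε D)

lemma stepSize_nonneg : 0 ≤ stepSize P S ε D y W y' W' := Real.sqrt_nonneg _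

lemma abs_dualSum_sweep_sub_le (h : IsCycle P S ε y W y' W') (hA : P.NonOverlapping) (hε : 0 < ε)
    (hD : 0 ≤ D) (hb : BoundedLog P S ε V D) (hV : dualVal P S ε y W ≤ V) (i : Fin N)
    (p : Fin n₁ × Fin n₂ × Fin n₃) :
    |dualSum P (partialSweep y y' (i + 1)) W p - dualSum P (partialSweep y y' i) W p| ≤
      stepSize P S ε D y W y' W' := by
  have hi : (i : ℕ) + 1 ≤ N := i.2
  refine Real.abs_le_sqrt ?_
  rw [le_div_iff₀ (descentConst_pos hε hD), mul_comm]
  have hold := h.dualVal_sweep_le (s := i) (by omega)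
  have hnew := h.dualVal_mid_le_sweep hi
  refine (sq_dualSum_sub_le hε hD (hb _ _ h.inDom (hold.trans hV))
    (hb _ _ h.inDom ((h.dualVal_sweep_le hi).trans hV)) (fun k j => ?_) (fun q => by simp) p).trans
    (by linarith [h.dualVal_le_mid])
  by_cases hk : k = i
  · subst hk
    rw [h.Amap_partialSweep hA hε, sub_self, mul_zero]
  · have : (k : ℕ) ≠ i := fun h => hk (Fin.ext h)
    have h1 : ((k : ℕ) < i + 1) ↔ (k : ℕ) < i := by omega
    simp [partialSweep, h1]

lemma abs_dualSum_last_sub_le (h : IsCycle P S ε y W y' W') (hε : 0 < ε)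
    (hD : 0 ≤ D) (hb : BoundedLog P S ε V D) (hV : dualVal P S ε y W ≤ V)
    (p : Fin n₁ × Fin n₂ × Fin n₃) :
    |dualSum P y' W' p - dualSum P y' W p| ≤ stepSize P S ε D y W y' W' := by
  refine Real.abs_le_sqrt ?_
  rw [le_div_iff₀ (descentConst_pos hε hD), mul_comm]
  have hmid : dualVal P S ε y' W ≤ dualVal P S ε y W := by
    have := h.dualVal_sweep_le le_rfl
    rwa [partialSweep_last] at this
  refine (sq_dualSum_sub_le hε hD (hb _ _ h.inDom (hmid.trans hV))
    (hb _ _ h.inDom' (h.dualVal_le.trans hV)) (fun k j => by simp) (fun q => ?_) p).trans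
    (by linarith)
  obtain ⟨h1, h2⟩ := h.le_U_and_slack hε q
  by_cases hU : P.U q = ⊤
  · rw [(h.inDom q).2 hU, (h.inDom' q).2 hU, sub_self, zero_mul]
  · nlinarith [mul_nonneg (neg_nonneg.2 (h.inDom q).1) (sub_nonneg.2 (h1 hU))]

lemma abs_y_sub_le (h : IsCycle P S ε y W y' W') (hA : P.NonOverlapping) (hε : 0 < ε)
    (hD : 0 ≤ D) (hb : BoundedLog P S ε V D) (hV : dualVal P S ε y W ≤ V) (i : Fin N)
    (j : Fin (m i)) : |y' i j - y i j| ≤ stepSize P S ε D y W y' W' := by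
  -- an entry `p` in the support of `A i j`; no other tensor of the block is supported there
  obtain ⟨p, hp⟩ : ∃ p, P.A i j p ≠ 0 := Function.ne_iff.1 (hA.2.1 i j)
  have hp1 : P.A i j p = 1 := (hA.1 i j p).resolve_left hp
  have h1 := h.abs_dualSum_sweep_sub_le hA hε hD hb hV i p
  rw [dualSum_sub_of_forall_ne (i := i), Finset.sum_eq_single j] at h1
  · simpa [partialSweep, hp1] using h1
  · intro k _ hk
    have := hA.2.2 i j k (Ne.symm hk) p
    rw [hp1, one_mul] at this
    rw [this, mul_zero]
  · simp
  · intro k hk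
    have : (k : ℕ) ≠ i := fun h => hk (Fin.ext h)
    have h1 : ((k : ℕ) < i + 1) ↔ (k : ℕ) < i := by omega
    simp [partialSweep, h1]

lemma abs_W_sub_le (h : IsCycle P S ε y W y' W') (hε : 0 < ε)
    (hD : 0 ≤ D) (hb : BoundedLog P S ε V D) (hV : dualVal P S ε y W ≤ V)
    (p : Fin n₁ × Fin n₂ × Fin n₃) : |W' p - W p| ≤ stepSize P S ε D y W y' W' := by
  have := h.abs_dualSum_last_sub_le hε hD hb hV p
  rwa [dualSum_sub_of_W] at this

lemma abs_dualSum_sub_sweep_le (h : IsCycle P S ε y W y' W') (hA : P.NonOverlapping) (hε : 0 < ε)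
    (hD : 0 ≤ D) (hb : BoundedLog P S ε V D) (hV : dualVal P S ε y W ≤ V) {s : ℕ} (hs : s ≤ N)
    (p : Fin n₁ × Fin n₂ × Fin n₃) :
    |dualSum P y' W' p - dualSum P (partialSweep y y' s) W p| ≤
      (N + 1) * stepSize P S ε D y W y' W' := by
  have key : ∀ k, s + k ≤ N → |dualSum P (partialSweep y y' (s + k)) W p -
      dualSum P (partialSweep y y' s) W p| ≤ k * stepSize P S ε D y W y' W' := by
    intro k
    induction k with
    | zero => simp
    | succ k ih =>
      intro hk
      have h1 := h.abs_dualSum_sweep_sub_le hA hε hD hb hV ⟨s + k, hk⟩ p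
      have h2 := ih (by omega)
      have h3 := abs_sub_le (dualSum P (partialSweep y y' (s + (k + 1))) W p)
        (dualSum P (partialSweep y y' (s + k)) W p) (dualSum P (partialSweep y y' s) W p)
      rw [← add_assoc] at h3 ⊢
      push_cast
      simp only at h1
      linarith
  have h1 := key (N - s) (by omega)
  rw [Nat.add_sub_cancel' hs, partialSweep_last] at h1
  have h2 := h.abs_dualSum_last_sub_le hε hD hb hV p
  have h3 := abs_sub_le (dualSum P y' W' p) (dualSum P y' W p)
    (dualSum P (partialSweep y y' s) W p)
  have h4 : ((N - s : ℕ) : ℝ) ≤ N := by exact_mod_cast Nat.sub_le N s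
  have h5 := mul_le_mul_of_nonneg_right h4
    (stepSize_nonneg (P := P) (S := S) (ε := ε) (D := D) (y := y) (W := W) (y' := y') (W' := W'))
  linarith

/-- After a cycle the equality constraints are violated at most proportionally to the step size:
each block held exactly when it was updated. -/
lemma abs_Amap_sub_le (h : IsCycle P S ε y W y' W') (hA : P.NonOverlapping) (hε : 0 < ε)
    (hD : 0 ≤ D) (hb : BoundedLog P S ε V D) (hV : dualVal P S ε y W ≤ V) (i : Fin N)
    (j : Fin (m i)) : |P.Amap i (primalOf P S ε y' W') j - P.b i j| ≤
      Fintype.card (Fin n₁ × Fin n₂ × Fin n₃) * (Real.exp D * (ε⁻¹ * (N + 1))) *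
        stepSize P S ε D y W y' W' := by
  have hi : (i : ℕ) + 1 ≤ N := i.2
  rw [← h.Amap_partialSweep hA hε i]
  unfold LPData.Amap tinner
  rw [← Finset.sum_sub_distrib]
  refine (Finset.abs_sum_le_sum_abs _ _).trans ?_
  have : ∀ p ∈ Finset.univ, |P.A i j p * primalOf P S ε y' W' p -
      P.A i j p * primalOf P S ε (partialSweep y y' (i + 1)) W p| ≤
      Real.exp D * (ε⁻¹ * (N + 1)) * stepSize P S ε D y W y' W' := by
    intro p _
    have h1 : |P.A i j p| ≤ 1 := by rcases hA.1 i j p with h | h <;> simp [h]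
    rw [← mul_sub, abs_mul]
    refine (mul_le_of_le_one_left (abs_nonneg _) h1).trans ?_
    refine (abs_primalOf_sub_le hε
      (primalOf_le_exp (hb _ _ h.inDom' (h.dualVal_le.trans hV) p))
      (primalOf_le_exp (hb _ _ h.inDom ((h.dualVal_sweep_le hi).trans hV) p))).trans ?_
    rw [mul_assoc, mul_assoc]
    gcongr
    exact h.abs_dualSum_sub_sweep_le hA hε hD hb hV hi p
  refine (Finset.sum_le_sum this).trans (le_of_eq ?_)
  rw [Finset.sum_const, nsmul_eq_mul, Finset.card_univ]
  ring

end IsCycle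

/-! ### The suboptimality after a cycle -/

/-- All the maps `𝒜⁽ⁱ⁾` together, as a linear map. -/
def AmapLin (P : LPData n₁ n₂ n₃ N m) : Tensor n₁ n₂ n₃ →ₗ[ℝ] Blocks m where
  toFun X i := P.Amap i X
  map_add' X Y := by
    funext i j
    simp [LPData.Amap, tinner, mul_add, Finset.sum_add_distrib]
  map_smul' c X := by
    funext i j
    simp only [LPData.Amap, tinner, Pi.smul_apply, smul_eq_mul, RingHom.id_apply, Finset.mul_sum]
    exact Finset.sum_congr rfl fun p _ => by ring

/-- After a cycle, the dual objective exceeds any other value by at most the square of the step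
size. The Hoffman bound provides a feasible tensor near the current primal tensor with the same
active upper bounds; its duality gap is a pure relative entropy, hence quadratic. -/
lemma exists_dualVal_sub_le (hA : P.NonOverlapping) (hΩ : P.Feasible) (hε : 0 < ε) {V D : ℝ}
    (hD : 0 ≤ D) (hb : BoundedLog P S ε V D) :
    ∃ K : ℝ, 0 ≤ K ∧ ∀ (y y' : Blocks m) (W W' : Tensor n₁ n₂ n₃), IsCycle P S ε y W y' W' →
      dualVal P S ε y W ≤ V → ∀ (z : Blocks m) (Z : Tensor n₁ n₂ n₃), InDom P Z →
      dualVal P S ε y' W' - dualVal P S ε z Z ≤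
        K * IsCycle.stepSize P S ε D y W y' W' ^ 2 := by
  classical
  obtain ⟨X₀, hX₀, -⟩ := hΩ.2
  -- an infinite bound is replaced by `exp D`, which no entry of the iterates exceeds
  set up : Tensor n₁ n₂ n₃ := fun p => if P.U p = ⊤ then Real.exp D else (P.U p).toReal with hup
  set lo : Tensor n₁ n₂ n₃ := fun _ => Real.exp (-D)
  obtain ⟨κ, hκ, η, hη, hH⟩ := exists_hoffman_box (AmapLin P) P.b lo up
  set r : ℝ := Fintype.card (Fin n₁ × Fin n₂ × Fin n₃) * (Real.exp D * (ε⁻¹ * (N + 1))) with hr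
  have hr0 : 0 ≤ r := by positivity
  set K₁ : ℝ := ε * (Fintype.card (Fin n₁ × Fin n₂ × Fin n₃) * ((κ * r) ^ 2 * Real.exp D)) with hK₁
  set K₂ : ℝ := |V + entropicCost P S ε X₀| * (r / η) ^ 2 with hK₂
  refine ⟨K₁ + K₂, by positivity, fun y y' W W' h hV z Z hZ => ?_⟩
  set δ := IsCycle.stepSize P S ε D y W y' W' with hδ
  have hδ0 : 0 ≤ δ := IsCycle.stepSize_nonneg
  set X := primalOf P S ε y' W' with hX
  have hlog : ∀ p, |Real.log (X p)| ≤ D := hb _ _ h.inDom' (h.dualVal_le.trans hV)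
  have hres : ‖AmapLin P X - P.b‖ ≤ r * δ := by
    refine (pi_norm_le_iff_of_nonneg (by positivity)).2 fun i => ?_
    refine (pi_norm_le_iff_of_nonneg (by positivity)).2 fun j => ?_
    exact h.abs_Amap_sub_le hA hε hD hb hV i j
  have hbox : X ∈ Set.Icc lo up := by
    refine ⟨fun p => exp_neg_le_primalOf (hlog p), fun p => ?_⟩
    by_cases hU : P.U p = ⊤
    · simpa [hup, hU] using primalOf_le_exp (hlog p)
    · simpa [hup, hU] using (h.le_U_and_slack hε p).1 hU
  by_cases hsmall : ‖AmapLin P X - P.b‖ ≤ η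
  · obtain ⟨Y, hY, hYb, hYact, hYX⟩ := hH X hbox hsmall
    have hYpos : ∀ p, 0 < Y p := fun p => (Real.exp_pos _).trans_le (hY.1 p)
    have hYΩ : Y ∈ P.Omega := by
      refine ⟨⟨fun i => congrFun hYb i, fun p => coe_le_U_iff.2 fun hU => ?_⟩,
        fun p => (hYpos p).le⟩
      have := hY.2 p
      simpa [hup, hU] using this
    have h1 := neg_entropicCost_le_dualVal (S := S) hε hYΩ z hZ
    have h2 := dualVal_add_entropicCost (S := S) hε hYΩ.1.1 y' W'
    have h3 : ∑ p, -W' p * ((P.U p).toReal - Y p) = 0 := by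
      refine Finset.sum_eq_zero fun p _ => ?_
      by_cases hU : P.U p = ⊤
      · rw [(h.inDom' p).2 hU]; simp
      rcases mul_eq_zero.1 (h.le_U_and_slack hε p).2 with h0 | h0
      · rw [h0]; simp
      · have hact : Y p = up p := hYact p (by simp only [hup, hU, if_false]; linarith)
        simp [hact, hup, hU]
    have h4 : ∀ p ∈ Finset.univ, relEnt (Y p) (X p) ≤ (κ * r) ^ 2 * Real.exp D * δ ^ 2 := by
      intro p _
      have hXp : 0 < X p := primalOf_pos _ _ p
      have h5 : |Y p - X p| ≤ κ * r * δ := by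
        rw [mul_assoc]
        exact (norm_le_pi_norm (Y - X) p).trans (hYX.trans (by gcongr))
      have h6 : (X p)⁻¹ ≤ Real.exp D := by
        rw [← inv_inv (Real.exp D), ← Real.exp_neg]
        exact inv_anti₀ (Real.exp_pos _) (exp_neg_le_primalOf (hlog p))
      calc relEnt (Y p) (X p) ≤ (Y p - X p) ^ 2 / X p := relEnt_le_sq_div (hYpos p) hXp
        _ = |Y p - X p| ^ 2 * (X p)⁻¹ := by rw [sq_abs]; rfl
        _ ≤ (κ * r * δ) ^ 2 * Real.exp D := by gcongr
        _ = _ := by ring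
    have h7 : ε * ∑ p, relEnt (Y p) (X p) ≤ K₁ * δ ^ 2 := by
      have := mul_le_mul_of_nonneg_left (Finset.sum_le_sum h4) hε.le
      rw [Finset.sum_const, nsmul_eq_mul, Finset.card_univ] at this
      refine this.trans (le_of_eq ?_)
      rw [hK₁]; ring
    have h8 : 0 ≤ K₂ * δ ^ 2 := by positivity
    rw [h3] at h2
    linarith
  · -- a residual above the threshold makes any bounded gap quadratic
    have h1 : η ≤ r * δ := (not_le.1 hsmall).le.trans hres
    have h2 : 1 ≤ (r / η) ^ 2 * δ ^ 2 := by
      rw [← mul_pow, div_mul_eq_mul_div]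
      exact one_le_pow₀ ((one_le_div hη).2 h1)
    have h3 := neg_entropicCost_le_dualVal (S := S) hε hX₀ z hZ
    have h4 : dualVal P S ε y' W' - dualVal P S ε z Z ≤ |V + entropicCost P S ε X₀| :=
      le_trans (by linarith [h.dualVal_le]) (le_abs_self _)
    have h5 := le_mul_of_one_le_right (abs_nonneg (V + entropicCost P S ε X₀)) h2
    have h6 : 0 ≤ K₁ * δ ^ 2 := by positivity
    have h7 : (K₁ + K₂) * δ ^ 2 = K₁ * δ ^ 2 +
        |V + entropicCost P S ε X₀| * ((r / η) ^ 2 * δ ^ 2) := by rw [hK₂]; ring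
    linarith

/-! ### Linear convergence -/

/-- If what is left above every later value is at most a multiple of the last decrease, the
decreases are bounded by a geometric sequence. -/
lemma exists_geometric_of_sub_le_mul_sub {g : ℕ → ℝ} {K : ℝ} (hK : 0 ≤ K)
    (hg : ∀ ℓ, g (ℓ + 1) ≤ g ℓ) (h : ∀ ℓ k, g (ℓ + 1) - g k ≤ K * (g ℓ - g (ℓ + 1))) :
    ∃ C : ℝ, 0 ≤ C ∧ ∃ θ : ℝ, 0 < θ ∧ θ < 1 ∧ ∀ ℓ, g ℓ - g (ℓ + 1) ≤ C * θ ^ ℓ := by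
  have hbdd : BddBelow (Set.range g) := by
    refine ⟨g 1 - K * (g 0 - g 1), ?_⟩
    rintro _ ⟨k, rfl⟩
    have := h 0 k
    simp only [zero_add] at this
    linarith
  set L := ⨅ k, g k with hL
  have hLle : ∀ k, L ≤ g k := fun k => ciInf_le hbdd k
  have hstep : ∀ ℓ, g (ℓ + 1) - L ≤ K * (g ℓ - g (ℓ + 1)) := by
    intro ℓ
    have : g (ℓ + 1) - K * (g ℓ - g (ℓ + 1)) ≤ L := le_ciInf fun k => by
      have := h ℓ k
      linarith
    linarith
  have hθ0 : 0 < (K + 1) / (K + 2) := by positivity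
  have hcontr : ∀ ℓ, g (ℓ + 1) - L ≤ (K + 1) / (K + 2) * (g ℓ - L) := by
    intro ℓ
    have h1 := hstep ℓ
    rw [div_mul_eq_mul_div, le_div_iff₀ (by positivity)]
    nlinarith [hg ℓ, hLle ℓ]
  have hgeo : ∀ ℓ, g ℓ - L ≤ (g 0 - L) * ((K + 1) / (K + 2)) ^ ℓ := by
    intro ℓ
    induction ℓ with
    | zero => simp
    | succ ℓ ih =>
      calc g (ℓ + 1) - L ≤ (K + 1) / (K + 2) * (g ℓ - L) := hcontr ℓ
        _ ≤ (K + 1) / (K + 2) * ((g 0 - L) * ((K + 1) / (K + 2)) ^ ℓ) := by gcongr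
        _ = _ := by ring
  refine ⟨g 0 - L, sub_nonneg.2 (hLle 0), (K + 1) / (K + 2), hθ0,
    (div_lt_one (by positivity)).2 (by linarith), fun ℓ => ?_⟩
  linarith [hgeo ℓ, hLle (ℓ + 1)]

lemma RLinear.of_le {e : ℕ → ℝ} {c ρ : ℝ} (hc : 0 ≤ c) (hρ0 : 0 < ρ) (hρ1 : ρ < 1)
    (h : ∀ ℓ, e ℓ ≤ c * ρ ^ ℓ) : RLinear e := by
  refine ⟨c + 1, by positivity, ρ, hρ0, hρ1, fun ℓ => (h ℓ).trans ?_⟩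
  have := pow_pos hρ0 ℓ
  nlinarith

lemma frobNorm_le {X : Tensor n₁ n₂ n₃} {d : ℝ} (hd : 0 ≤ d) (h : ∀ p, |X p| ≤ d) :
    frobNorm X ≤ Real.sqrt (Fintype.card (Fin n₁ × Fin n₂ × Fin n₃)) * d := by
  unfold frobNorm tinner
  rw [← Real.sqrt_sq hd, ← Real.sqrt_mul (Nat.cast_nonneg _)]
  refine Real.sqrt_le_sqrt ?_
  refine (Finset.sum_le_sum fun p _ => ?_).trans (le_of_eq (by
    rw [Finset.sum_const, nsmul_eq_mul, Finset.card_univ]))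
  rw [← sq]
  exact sq_le_sq' (neg_le_of_abs_le (h p)) ((le_abs_self _).trans (h p))

lemma dualNorm_le {y : Blocks m} {W : Tensor n₁ n₂ n₃} {d : ℝ} (hd : 0 ≤ d)
    (hy : ∀ i j, |y i j| ≤ d) (hW : ∀ p, |W p| ≤ d) :
    dualNorm y W ≤
      Real.sqrt (∑ i, (m i : ℝ) + Fintype.card (Fin n₁ × Fin n₂ × Fin n₃)) * d := by
  unfold dualNorm
  have hc : (0 : ℝ) ≤ ∑ i, (m i : ℝ) + Fintype.card (Fin n₁ × Fin n₂ × Fin n₃) := by positivity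
  rw [← Real.sqrt_sq hd, ← Real.sqrt_mul hc]
  refine Real.sqrt_le_sqrt ?_
  rw [add_mul, Finset.sum_mul]
  refine add_le_add (Finset.sum_le_sum fun i _ => ?_) ?_
  · refine (Finset.sum_le_sum fun j _ => sq_le_sq' (neg_le_of_abs_le (hy i j))
      ((le_abs_self _).trans (hy i j))).trans (le_of_eq (by
        rw [Finset.sum_const, nsmul_eq_mul, Finset.card_univ, Fintype.card_fin]))
  · refine (Finset.sum_le_sum fun p _ => sq_le_sq' (neg_le_of_abs_le (hW p))
      ((le_abs_self _).trans (hW p))).trans (le_of_eq (by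
        rw [Finset.sum_const, nsmul_eq_mul, Finset.card_univ]))

lemma abs_dualSum_sub_le (hA : P.NonOverlapping) {y y' : Blocks m} {W W' : Tensor n₁ n₂ n₃}
    {d : ℝ} (hy : ∀ i j, |y i j - y' i j| ≤ d) (hW : ∀ p, |W p - W' p| ≤ d)
    (p : Fin n₁ × Fin n₂ × Fin n₃) :
    |dualSum P y W p - dualSum P y' W' p| ≤ (1 + ∑ i, (m i : ℝ)) * d := by
  have h1 : dualSum P y W p - dualSum P y' W' p =
      (W p - W' p) + ∑ i, ∑ j, (y i j - y' i j) * P.A i j p := by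
    unfold dualSum LPData.Aadj
    simp only [sub_mul, Finset.sum_sub_distrib]
    ring
  rw [h1, add_mul, one_mul, Finset.sum_mul]
  refine (abs_add_le _ _).trans (add_le_add (hW p) ((Finset.abs_sum_le_sum_abs _ _).trans
    (Finset.sum_le_sum fun i _ => (Finset.abs_sum_le_sum_abs _ _).trans ?_)))
  have : ∀ j ∈ Finset.univ, |(y i j - y' i j) * P.A i j p| ≤ d := by
    intro j _
    rw [abs_mul]
    refine (mul_le_of_le_one_right (abs_nonneg _) ?_).trans (hy i j)
    rcases hA.1 i j p with h | h <;> simp [h]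
  refine (Finset.sum_le_sum this).trans (le_of_eq ?_)
  rw [Finset.sum_const, nsmul_eq_mul, Finset.card_univ, Fintype.card_fin]

lemma continuous_primalOf_apply (p : Fin n₁ × Fin n₂ × Fin n₃) :
    Continuous fun z : Blocks m × Tensor n₁ n₂ n₃ => primalOf P S ε z.1 z.2 p := by
  unfold primalOf dualSum LPData.Aadj
  fun_prop

/-- A limit of cycles with step sizes tending to zero satisfies the optimality conditions. -/
lemma isKKT_of_tendsto (hA : P.NonOverlapping) (hε : 0 < ε) {V D : ℝ} (hD : 0 ≤ D)
    (hb : BoundedLog P S ε V D) {y : ℕ → Blocks m} {W : ℕ → Tensor n₁ n₂ n₃}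
    (hcyc : ∀ ℓ, IsCycle P S ε (y ℓ) (W ℓ) (y (ℓ + 1)) (W (ℓ + 1)))
    (hV : ∀ ℓ, dualVal P S ε (y ℓ) (W ℓ) ≤ V)
    (hδ : Filter.Tendsto (fun ℓ => IsCycle.stepSize P S ε D (y ℓ) (W ℓ) (y (ℓ + 1)) (W (ℓ + 1)))
      Filter.atTop (nhds 0))
    {z : Blocks m × Tensor n₁ n₂ n₃}
    (hz : Filter.Tendsto (fun ℓ => (y ℓ, W ℓ)) Filter.atTop (nhds z)) :
    IsKKT P S ε z.1 z.2 := by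
  have hz1 := hz.comp (Filter.tendsto_add_atTop_nat 1)
  have hX : ∀ p, Filter.Tendsto (fun ℓ => primalOf P S ε (y (ℓ + 1)) (W (ℓ + 1)) p) Filter.atTop
      (nhds (primalOf P S ε z.1 z.2 p)) := fun p =>
    ((continuous_primalOf_apply p).tendsto z).comp hz1
  have hWp : ∀ p, Filter.Tendsto (fun ℓ => W (ℓ + 1) p) Filter.atTop (nhds (z.2 p)) := fun p =>
    ((Continuous.tendsto (f := fun z : Blocks m × Tensor n₁ n₂ n₃ => z.2 p) (by fun_prop) z)).comp
      hz1
  refine ⟨fun p => ⟨le_of_tendsto' (hWp p) fun ℓ => ((hcyc ℓ).inDom' p).1, fun hU => ?_⟩,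
    ⟨fun i => ?_, fun p => coe_le_U_iff.2 fun hU =>
      le_of_tendsto' (hX p) fun ℓ => ((hcyc ℓ).le_U_and_slack hε p).1 hU⟩, fun p => ?_⟩
  · refine tendsto_nhds_unique (hWp p) ?_
    simp only [((hcyc _).inDom' p).2 hU]
    exact tendsto_const_nhds
  · funext j
    have h1 : Filter.Tendsto (fun ℓ => P.Amap i (primalOf P S ε (y (ℓ + 1)) (W (ℓ + 1))) j)
        Filter.atTop (nhds (P.Amap i (primalOf P S ε z.1 z.2) j)) :=
      tendsto_finsetSum _ fun p _ => (hX p).const_mul (P.A i j p)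
    have h3 := hδ.const_mul
      (Fintype.card (Fin n₁ × Fin n₂ × Fin n₃) * (Real.exp D * (ε⁻¹ * (N + 1))) : ℝ)
    rw [mul_zero] at h3
    have h2 : Filter.Tendsto (fun ℓ =>
        P.Amap i (primalOf P S ε (y (ℓ + 1)) (W (ℓ + 1))) j - P.b i j) Filter.atTop (nhds 0) :=
      squeeze_zero_norm (fun ℓ => by
        rw [Real.norm_eq_abs]
        exact (hcyc ℓ).abs_Amap_sub_le hA hε hD hb (hV ℓ) i j) h3
    exact sub_eq_zero.1 (tendsto_nhds_unique (h1.sub_const _) h2)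
  · have h1 := (hWp p).mul ((hX p).const_sub (P.U p).toReal)
    refine tendsto_nhds_unique h1 ?_
    simp only [((hcyc _).le_U_and_slack hε p).2]
    exact tendsto_const_nhds

end DualBCD

end

theorem theorem2 {n₁ n₂ n₃ N : ℕ} {m : Fin N → ℕ} (P : DualBCD.LPData n₁ n₂ n₃ N m)
    (hA : P.NonOverlapping) (hΩ : P.Feasible)
    (S : DualBCD.Tensor n₁ n₂ n₃) (hS : ∀ p, 0 < S p) (ε : ℝ) (hε : 0 < ε)
    (y : ℕ → DualBCD.Blocks m) (W : ℕ → DualBCD.Tensor n₁ n₂ n₃)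
    (hBCD : DualBCD.IsDualBCD P S ε y W) :
    (∃ (ybar : DualBCD.Blocks m) (Wbar : DualBCD.Tensor n₁ n₂ n₃),
      DualBCD.IsDualOptimal P S ε ybar Wbar ∧
      DualBCD.RLinear (fun ℓ => DualBCD.dualNorm (y ℓ - ybar) (W ℓ - Wbar))) ∧
    (∃ Xbar : DualBCD.Tensor n₁ n₂ n₃,
      DualBCD.IsPrimalOptimal P S ε Xbar ∧
      (∀ X, DualBCD.IsPrimalOptimal P S ε X → X = Xbar) ∧
      DualBCD.RLinear (fun ℓ => DualBCD.frobNorm (DualBCD.primalOf P S ε (y ℓ) (W ℓ) - Xbar))) := by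
  open DualBCD in
  have hdom : ∀ ℓ, InDom P (W ℓ) := by
    intro ℓ
    induction ℓ with
    | zero => exact inDom_of_R_lt_top hBCD.1
    | succ ℓ ih => exact (isCycle_of_isMinOn ih (hBCD.2 ℓ).1 (hBCD.2 ℓ).2).inDom'
  have hcyc : ∀ ℓ, IsCycle P S ε (y ℓ) (W ℓ) (y (ℓ + 1)) (W (ℓ + 1)) := fun ℓ =>
    isCycle_of_isMinOn (hdom ℓ) (hBCD.2 ℓ).1 (hBCD.2 ℓ).2
  set g : ℕ → ℝ := fun ℓ => dualVal P S ε (y ℓ) (W ℓ) with hg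
  have hV : ∀ ℓ, g ℓ ≤ g 0 := fun ℓ =>
    antitone_nat_of_succ_le (fun ℓ => (hcyc ℓ).dualVal_le) (Nat.zero_le ℓ)
  obtain ⟨D, hD, hb⟩ := exists_boundedLog (S := S) hΩ hε (g 0)
  obtain ⟨K, hK, hgap⟩ := exists_dualVal_sub_le hA hΩ hε hD hb
  have hc := descentConst_pos hε hD
  set c := descentConst ε D
  set δ : ℕ → ℝ := fun ℓ => IsCycle.stepSize P S ε D (y ℓ) (W ℓ) (y (ℓ + 1)) (W (ℓ + 1)) with hδ
  have hδsq : ∀ ℓ, δ ℓ ^ 2 = (g ℓ - g (ℓ + 1)) / c := fun ℓ =>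
    Real.sq_sqrt (div_nonneg (sub_nonneg.2 (hcyc ℓ).dualVal_le) hc.le)
  obtain ⟨C, hC, θ, hθ0, hθ1, hgeo⟩ := exists_geometric_of_sub_le_mul_sub (g := g)
    (K := K / c) (by positivity) (fun ℓ => (hcyc ℓ).dualVal_le) fun ℓ k => by
      have h1 := hgap _ _ _ _ (hcyc ℓ) (hV ℓ) (y k) (W k) (hdom k)
      have h2 := hδsq ℓ
      simp only [hδ] at h2
      rw [h2] at h1
      refine h1.trans (le_of_eq ?_)
      ring
  -- the step sizes are square roots of the decreases, so they decay with ratio `√θ`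
  set ρ := Real.sqrt θ with hρ
  have hρ0 : 0 < ρ := Real.sqrt_pos.2 hθ0
  have hρ1 : ρ < 1 := by rw [hρ, Real.sqrt_lt' one_pos]; simpa using hθ1
  set C₁ := Real.sqrt (C / c) with hC₁
  have hδgeo : ∀ ℓ, δ ℓ ≤ C₁ * ρ ^ ℓ := by
    intro ℓ
    refine (sq_le_sq₀ IsCycle.stepSize_nonneg (by positivity)).1 ?_
    rw [hδsq, mul_pow, hC₁, Real.sq_sqrt (by positivity), ← pow_mul, mul_comm ℓ 2, pow_mul,
      hρ, Real.sq_sqrt hθ0.le, div_mul_eq_mul_div]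
    exact div_le_div_of_nonneg_right (hgeo ℓ) hc.le
  have hdist : ∀ ℓ, dist (y ℓ, W ℓ) (y (ℓ + 1), W (ℓ + 1)) ≤ C₁ * ρ ^ ℓ := by
    intro ℓ
    refine le_trans ?_ (hδgeo ℓ)
    have hδ0 : 0 ≤ δ ℓ := IsCycle.stepSize_nonneg
    rw [dist_comm, Prod.dist_eq]
    refine max_le ?_ ?_
    · refine (dist_pi_le_iff hδ0).2 fun i => (dist_pi_le_iff hδ0).2 fun j => ?_
      exact (hcyc ℓ).abs_y_sub_le hA hε hD hb (hV ℓ) i j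
    · refine (dist_pi_le_iff hδ0).2 fun p => ?_
      exact (hcyc ℓ).abs_W_sub_le hε hD hb (hV ℓ) p
  obtain ⟨z, hz⟩ := cauchySeq_tendsto_of_complete (cauchySeq_of_le_geometric ρ C₁ hρ1 hdist)
  have hlim := dist_le_of_le_geometric_of_tendsto ρ C₁ hρ1 hdist hz
  have hδlim : Filter.Tendsto δ Filter.atTop (nhds 0) :=
    squeeze_zero (fun ℓ => IsCycle.stepSize_nonneg) hδgeo
      (by simpa using (tendsto_pow_atTop_nhds_zero_of_lt_one hρ0.le hρ1).const_mul C₁)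
  have hkkt := isKKT_of_tendsto hA hε hD hb hcyc hV hδlim hz
  set d : ℕ → ℝ := fun ℓ => C₁ / (1 - ρ) * ρ ^ ℓ with hd
  have h1ρ : 0 < 1 - ρ := sub_pos.2 hρ1
  have hd0 : ∀ ℓ, 0 ≤ d ℓ := fun ℓ => by positivity
  have hdist' : ∀ ℓ, dist (y ℓ, W ℓ) z ≤ d ℓ := fun ℓ => (hlim ℓ).trans (le_of_eq (by
    rw [hd]; ring))
  have hdy : ∀ ℓ i j, |y ℓ i j - z.1 i j| ≤ d ℓ := fun ℓ i j =>
    ((dist_le_pi_dist (y ℓ i) (z.1 i) j).trans (dist_le_pi_dist (y ℓ) z.1 i)).trans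
      ((le_max_left _ _).trans (hdist' ℓ))
  have hdW : ∀ ℓ p, |W ℓ p - z.2 p| ≤ d ℓ := fun ℓ p =>
    (dist_le_pi_dist (W ℓ) z.2 p).trans ((le_max_right _ _).trans (hdist' ℓ))
  refine ⟨⟨z.1, z.2, hkkt.isDualOptimal hε, ?_⟩, primalOf P S ε z.1 z.2,
    hkkt.isPrimalOptimal hε hS, fun X hX => hkkt.eq_of_isPrimalOptimal hε hS hX, ?_⟩
  · refine RLinear.of_le (c := Real.sqrt (∑ i, (m i : ℝ) +
      Fintype.card (Fin n₁ × Fin n₂ × Fin n₃)) * (C₁ / (1 - ρ))) (by positivity) hρ0 hρ1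
      fun ℓ => ?_
    rw [mul_assoc]
    exact dualNorm_le (hd0 ℓ) (hdy ℓ) (hdW ℓ)
  · have hXle : ∀ ℓ p, primalOf P S ε (y ℓ) (W ℓ) p ≤ Real.exp D := fun ℓ p =>
      primalOf_le_exp (hb _ _ (hdom ℓ) (hV ℓ) p)
    have hXbar : ∀ p, primalOf P S ε z.1 z.2 p ≤ Real.exp D := fun p =>
      le_of_tendsto' (((continuous_primalOf_apply p).tendsto z).comp hz) fun ℓ => hXle ℓ p
    refine RLinear.of_le (c := Real.sqrt (Fintype.card (Fin n₁ × Fin n₂ × Fin n₃)) *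
      (Real.exp D * (ε⁻¹ * (1 + ∑ i, (m i : ℝ)))) * (C₁ / (1 - ρ))) (by positivity) hρ0 hρ1
      fun ℓ => ?_
    have hE : ∀ p, |(primalOf P S ε (y ℓ) (W ℓ) - primalOf P S ε z.1 z.2) p| ≤
        Real.exp D * (ε⁻¹ * (1 + ∑ i, (m i : ℝ))) * d ℓ := by
      intro p
      refine (abs_primalOf_sub_le hε (hXle ℓ p) (hXbar p)).trans ?_
      rw [mul_assoc, mul_assoc]
      gcongr
      exact abs_dualSum_sub_le hA (hdy ℓ) (hdW ℓ) p
    refine (frobNorm_le (mul_nonneg (by positivity) (hd0 ℓ)) hE).trans (le_of_eq ?_)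
    rw [hd]; ring
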